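/- **Setting.** Let $d\ge 3$, $n\ge 1$, $1\le s<d$ and $\delta\in(0,1)$. Let $y_i=\mathbf x_i^\top\beta^*+\xi_i$ for $i=1,\dots,n$, where $\beta^*\in\mathbb R^d$ has at most $s$ non-zero entries. The pairs $(\mathbf x_1,\xi_1),\dots,(\mathbf x_n,\xi_n)$ are independent, the random vectors $\mathbf x_i\in\mathbb R^d$ are identically distributed, and the real random variables $\xi_i$ are identically distributed. For $v\in\mathbb R^d$, $\|v\|_0$ is the number of non-zero entries of $v$, and $v_J$ is the vector that agrees with $v$ on $J$ and is $0$ outside $J$. Put $\ell=\log(d/\delta)/n$ and $c_\beta=\max_j|\beta^*_j|$. Let $H(t)=t^2/2$ for $|t|\le 1$, $H(t)=|t|-1/2$ for $|t|>1$ (Huber loss), and $h=H'$. **Assumptions.** For constants $K$, $\sigma$, $c_{\mathrm{RE}}>1$, $\kappa>0$ and $\kappa_l>0$: 1. $\mathbf x_i$ has finite fourth moments, $\mathbb E\mathbf x_i=0$, $\mathbb E\langle v,\mathbf x_i\rangle^4\le K^4(\mathbb E\langle v,\mathbf x_i\rangle^2)^2$ for all $v\in\mathbb R^d$, and $\max_j\mathbb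 E\mathbf x_{i_j}^2\le 1$. The matrix $\Sigma=\mathbb E\mathbf x_i\mathbf x_i^\top$ satisfies the restricted eigenvalue condition $\mathrm{RE}(s,c_{\mathrm{RE}},\kappa)$: $\|\Sigma^{1/2}v\|_2\ge\kappa\|v_J\|_2$ for all $v\in\mathbb R^d$ and all $J\subset\{1,\dots,d\}$ with $|J|\le s$ and $\|v_{J^c}\|_1\le c_{\mathrm{RE}}\|v_J\|_1$. Moreover $v^\top\Sigma v\ge\kappa_l^2$ for all $v$ with $\|v\|_2=1$ and $\|v\|_0\le s$. 2. $\mathbb E|\xi_i|\le\sigma<\infty$. 3. $\mathbb E\big[h\big(\xi_i/(\lambda_o\sqrt n)\big)\,\mathbf x_i\big]=0$. **Estimator.** Clip each coordinate, $\tilde{\mathbf x}_{i_j}=\mathrm{sgn}(\mathbf x_{i_j})\min(|\mathbf x_{i_j}|,\tau_{\mathbf x})$, and let $\hat\beta$ be a minimizer over $\beta\in\mathbb R^d$ of $$\sum_{i=1}^n\lambda_o^2\,H\Big(\frac{y_i-\tilde{\mathbf x}_i^\top\beta}{\lambda_o\sqrt n}\Big)+\lambda_s\|\beta\|_1 .$$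 **Tuning.** Let $$\tau_{\mathbf x}=\sqrt{\tfrac{n}{\log(d/\delta)}},\qquad \lambda_o\sqrt n\ge 18K^4(\sigma+1),\qquad \lambda_s=c_s\,\frac{c_{\mathrm{RE}}+1}{c_{\mathrm{RE}}-1}\,\lambda_o\sqrt n\,\sqrt{\ell},\qquad c_s\ge 16,$$ $$c_r\ge 6,\qquad c_{r_1}=\frac{c_r(1+c_{\mathrm{RE}})}{\kappa},\qquad c_{r_2}=\frac{c_r(1+c_{\mathrm{RE}})}{\kappa_l},$$ $$r_\Sigma=12\,c_{r_1}\sqrt s\,\lambda_s,\qquad r_1=c_{r_1}\sqrt s\,r_\Sigma,\qquad r_2=c_{r_2}r_\Sigma .$$ Assume $r_\Sigma\le 1$ and $$\max\Big\{9K^2c_{r_1}\sqrt{s\ell},\ \ \frac{K^4}{c_{r_1}}\,c_\beta^{1/4}s^{1/4}\ell^{7/8},\ \ \|\beta^*\|_1K^4\ell^{3/2}\Big\}\le 1 .$$ **Conclusion.** A minimizer $\hat\beta$ always exists. There is an event of probability at least $1-2\delta$ on which every minimizer $\hat\beta$ satisfies $$\|\Sigma^{1/2}(\hat\beta-\beta^*)\|_2\le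 r_\Sigma,\qquad \|\hat\beta-\beta^*\|_1\le r_1,$$ and, provided $c_{r_1}\le c_{r_2}$ (that is, $\kappa_l\le\kappa$), also $$\|\hat\beta-\beta^*\|_2\le r_2 .$$ (For $\lambda_o\sqrt n=18K^4(\sigma+1)$ this gives $r_\Sigma=216\,c_rc_s\frac{(c_{\mathrm{RE}}+1)^2}{c_{\mathrm{RE}}-1}\cdot\frac{K^4(1+\sigma)}{\kappa}\sqrt{s\log(d/\delta)/n}$.) -/

import Mathlib

open MeasureTheory ProbabilityTheory
open scoped MatrixOrder

noncomputable section

namespace SparseHuber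

/-- The `ℓ₁` norm of a vector. -/
def l1Norm {d : ℕ} (v : EuclideanSpace ℝ (Fin d)) : ℝ := ∑ j, |v j|

/-- The number of non-zero entries of a vector. -/
def l0Norm {d : ℕ} (v : EuclideanSpace ℝ (Fin d)) : ℕ :=
  (Finset.univ.filter fun j => v j ≠ 0).card

/-- The vector `v_J`: equal to `v` on `J` and zero outside `J`. -/
def restrict {d : ℕ} (v : EuclideanSpace ℝ (Fin d)) (J : Finset (Fin d)) :
    EuclideanSpace ℝ (Fin d) :=
  WithLp.toLp 2 fun j => if j ∈ J then v j else 0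

/-- The quantity `‖Σ^{1/2} v‖₂`, where `Σ^{1/2}` is the positive semidefinite square root. -/
def sqrtNorm {d : ℕ} (S : Matrix (Fin d) (Fin d) ℝ) (v : EuclideanSpace ℝ (Fin d)) : ℝ :=
  ‖Matrix.toEuclideanLin (CFC.sqrt S) v‖

/-- For a positive semidefinite matrix, `‖Σ^{1/2} v‖₂² = vᵀ Σ v`. -/
theorem sqrtNorm_sq {d : ℕ} {S : Matrix (Fin d) (Fin d) ℝ} (hS : S.PosSemidef)
    (v : EuclideanSpace ℝ (Fin d)) :
    sqrtNorm S v ^ 2 = v.ofLp ⬝ᵥ S.mulVec v.ofLp := by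
  have h1 : CFC.sqrt S * CFC.sqrt S = S := CFC.sqrt_mul_sqrt_self S hS.nonneg
  have h2 : (CFC.sqrt S).transpose = CFC.sqrt S := by
    have := (Matrix.nonneg_iff_posSemidef.mp (CFC.sqrt_nonneg S)).isHermitian
    simpa [Matrix.IsHermitian, Matrix.conjTranspose_eq_transpose_of_trivial] using this
  have h3 : sqrtNorm S v ^ 2
      = (CFC.sqrt S).mulVec v.ofLp ⬝ᵥ (CFC.sqrt S).mulVec v.ofLp := by
    rw [sqrtNorm, EuclideanSpace.norm_sq_eq]
    simp [dotProduct, sq]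
  rw [h3, Matrix.dotProduct_mulVec, Matrix.vecMul_mulVec, h2, h1, Matrix.dotProduct_mulVec,
    dotProduct_comm]

/-- The restricted eigenvalue condition `RE(s, c, κ)`. -/
def RestrictedEigenvalue {d : ℕ} (S : Matrix (Fin d) (Fin d) ℝ) (s : ℕ) (c κ : ℝ) : Prop :=
  0 < c ∧ 0 < κ ∧
    ∀ (v : EuclideanSpace ℝ (Fin d)) (J : Finset (Fin d)), J.card ≤ s →
      l1Norm (restrict v Jᶜ) ≤ c * l1Norm (restrict v J) →
      κ * ‖restrict v J‖ ≤ sqrtNorm S v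

/-- `vᵀ Σ v ≥ κ²` for all `s`-sparse unit vectors `v`, where `κ > 0`. -/
def SparseEigenvalue {d : ℕ} (S : Matrix (Fin d) (Fin d) ℝ) (s : ℕ) (κ : ℝ) : Prop :=
  0 < κ ∧ ∀ v : EuclideanSpace ℝ (Fin d), ‖v‖ = 1 → l0Norm v ≤ s →
    κ ^ 2 ≤ v.ofLp ⬝ᵥ S.mulVec v.ofLp

/-- A random vector has finite kurtosis with constant `K`: it has a finite fourth moment and
`E⟨v, Z - EZ⟩⁴ ≤ K⁴ (E⟨v, Z - EZ⟩²)²` for every `v`. -/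
def FiniteKurtosis {d : ℕ} {Ω : Type*} [MeasurableSpace Ω] (μ : Measure Ω)
    (Z : Ω → EuclideanSpace ℝ (Fin d)) (K : ℝ) : Prop :=
  MemLp Z 4 μ ∧ ∀ v : EuclideanSpace ℝ (Fin d),
    ∫ ω, inner ℝ v (Z ω - ∫ ω', Z ω' ∂μ) ^ 4 ∂μ
      ≤ K ^ 4 * (∫ ω, inner ℝ v (Z ω - ∫ ω', Z ω' ∂μ) ^ 2 ∂μ) ^ 2

/-- The matrix `E[Z Zᵀ]`. -/
def secondMoment {d : ℕ} {Ω : Type*} [MeasurableSpace Ω] (μ : Measure Ω)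
    (Z : Ω → EuclideanSpace ℝ (Fin d)) : Matrix (Fin d) (Fin d) ℝ :=
  Matrix.of fun j k => ∫ ω, Z ω j * Z ω k ∂μ

/-- The Huber loss `H`. -/
def huber (t : ℝ) : ℝ := if |t| ≤ 1 then t ^ 2 / 2 else |t| - 1 / 2

/-- The derivative `h = H'` of the Huber loss. -/
def huberScore (t : ℝ) : ℝ := deriv huber t

/-- Coordinatewise clipping of all the covariates at level `τ`. -/
def thresholding {n d : ℕ} (x : Fin n → EuclideanSpace ℝ (Fin d)) (τ : ℝ) :
    Fin n → EuclideanSpace ℝ (Fin d) :=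
  fun i => WithLp.toLp 2 fun j => Real.sign (x i j) * min |x i j| τ

/-- The objective function of `ℓ₁`-penalized Huber regression. -/
def huberObjective {n d : ℕ} (y : Fin n → ℝ) (x : Fin n → EuclideanSpace ℝ (Fin d))
    (lamO lamS : ℝ) (β : EuclideanSpace ℝ (Fin d)) : ℝ :=
  (∑ i, lamO ^ 2 * huber ((y i - inner ℝ (x i) β) / (lamO * √(n : ℝ)))) + lamS * l1Norm β

/-- The set of outputs of `ℓ₁`-penalized Huber regression: all minimizers of the objective. -/
def penalizedHuberRegression {n d : ℕ} (y : Fin n → ℝ) (x : Fin n → EuclideanSpace ℝ (Fin d))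
    (lamO lamS : ℝ) : Set (EuclideanSpace ℝ (Fin d)) :=
  {β | IsMinOn (huberObjective y x lamO lamS) Set.univ β}

/-- The set of outputs of the estimation procedure: clip the covariates at `τ`, then run
`ℓ₁`-penalized Huber regression on the clipped data. -/
def robustSparseEstimation {n d : ℕ} (y : Fin n → ℝ) (x : Fin n → EuclideanSpace ℝ (Fin d))
    (τ lamO lamS : ℝ) : Set (EuclideanSpace ℝ (Fin d)) :=
  penalizedHuberRegression y (thresholding x τ) lamO lamS

end SparseHuber

end

open SparseHuber

/-! A small gradient at `βstar` forces the error of a minimizer into a cone. Strong convexity on the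
part of the cone where the `Σ`-norm equals `rS` then keeps the error inside that radius, because the
objective is convex and an error that is too large can be shrunk onto the sphere. This deterministic
half is `error_bound_of_gradient_of_curvature`; the restricted eigenvalue condition converts the
`Σ`-norm into the `ℓ₁` and `ℓ₂` norms.

Gradient. With `r = 1 / τ`, clipping makes `r` times a score coordinate bounded by one with second
moment at most `r²`, so a Chernoff bound and a union over coordinates suffice. The unclipped score
has mean zero. Clipping biases it only when the `j`-th coordinate or one in the support of `βstar`
exceeds `τ`, and fourth moments bound this by `(2s+1) K⁴ r³` (`abs_integral_score_le`), whatever the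
size of the entries of `βstar`.

Curvature. Where the residual is at most `1/2`, the Huber loss exceeds its tangent by half of a
square capped at `Λ²/4` (`huber_sub_lower`). The kurtosis bound keeps the mean of these capped
squares of order `ρ²` (`integral_truncatedSq_ge`). Being bounded and nonnegative, they have a lower
tail relative to the mean (`measureReal_truncatedSq_le_le`).

Uniformity. Maurey's method replaces a point of an `ℓ₁` ball by an average of `m` vertices, close in
the empirical and the population quadratic forms at once. There are only `(2d)^m` such averages, so
a union bound over them is affordable (`exists_good_event`, `sum_truncatedSq_gt`). -/

noncomputable section

namespace SparseHuber

/-! ### The Huber loss: convex duality, derivative and local curvature. -/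

/-- Truncation of a real number to `[-1, 1]`. -/
def trunc (t : ℝ) : ℝ := max (-1) (min t 1)

theorem abs_trunc_le (t : ℝ) : |trunc t| ≤ 1 := by
  rw [abs_le]; unfold trunc
  exact ⟨le_max_left _ _, max_le (by norm_num) (min_le_right _ _)⟩

theorem trunc_eq_self {t : ℝ} (h : |t| ≤ 1) : trunc t = t := by
  rw [abs_le] at h
  unfold trunc
  rw [min_eq_left h.2, max_eq_right h.1]

theorem continuous_trunc : Continuous trunc := by unfold trunc; fun_prop

theorem huber_eq (t : ℝ) : huber t = trunc t * t - trunc t ^ 2 / 2 := by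
  unfold huber
  split_ifs with h
  · rw [trunc_eq_self h]; ring
  · push Not at h
    rcases le_or_gt 0 t with h0 | h0
    · rw [abs_of_nonneg h0] at h ⊢
      have : trunc t = 1 := by
        unfold trunc; rw [min_eq_right h.le, max_eq_right (by norm_num)]
      rw [this]; ring
    · rw [abs_of_neg h0] at h ⊢
      have : trunc t = -1 := by
        unfold trunc; rw [min_eq_left (by linarith), max_eq_left (by linarith)]
      rw [this]; ring

/-- Fenchel–Young: the loss is the conjugate of `c²/2` on `[-1, 1]`, and `huber_eq` says that `trunc
t` attains the supremum. The lower bounds on the loss below come from a choice of slope `c`. -/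
theorem le_huber {c : ℝ} (hc : |c| ≤ 1) (t : ℝ) : c * t - c ^ 2 / 2 ≤ huber t := by
  unfold huber
  split_ifs with h
  · nlinarith [sq_nonneg (c - t)]
  · have h1 : c * t ≤ |c| * |t| := by rw [← abs_mul]; exact le_abs_self _
    rw [← sq_abs c]
    push Not at h
    nlinarith [abs_nonneg c]

theorem huber_tangent (u v : ℝ) : huber u + trunc u * (v - u) ≤ huber v := by
  have := le_huber (abs_trunc_le u) v
  rw [huber_eq u]; linarith

theorem huber_nonneg (t : ℝ) : 0 ≤ huber t := by
  simpa using le_huber (c := 0) (by simp) t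

theorem continuous_huber : Continuous huber := by
  have : huber = fun t => trunc t * t - trunc t ^ 2 / 2 := funext huber_eq
  rw [this]
  have := continuous_trunc
  fun_prop

theorem convexOn_huber : ConvexOn ℝ Set.univ huber := by
  refine ⟨convex_univ, fun u _ v _ a b ha hb hab => ?_⟩
  simp only [smul_eq_mul]
  have h1 := mul_le_mul_of_nonneg_left (huber_tangent (a * u + b * v) u) ha
  have h2 := mul_le_mul_of_nonneg_left (huber_tangent (a * u + b * v) v) hb
  have : b = 1 - a := by linarith
  subst this
  nlinarith

/-- The tangent inequalities at `t` and at `v` trap the remainder between `0` and `(trunc v - trunc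
t) * (v - t)`, which is `o(v - t)` by continuity of `trunc`. -/
theorem hasDerivAt_huber (t : ℝ) : HasDerivAt huber (trunc t) t := by
  have key : ∀ v, 0 ≤ huber v - huber t - trunc t * (v - t) ∧
      huber v - huber t - trunc t * (v - t) ≤ (trunc v - trunc t) * (v - t) := fun v => by
    have h1 := huber_tangent t v
    have h2 := huber_tangent v t
    constructor <;> linarith
  rw [hasDerivAt_iff_isLittleO]
  rw [Asymptotics.isLittleO_iff]
  intro c hc
  have hcont := continuous_trunc.continuousAt (x := t)
  filter_upwards [Metric.continuousAt_iff'.1 hcont c hc] with v hv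
  rw [Real.dist_eq] at hv
  have := key v
  rw [smul_eq_mul, Real.norm_eq_abs, Real.norm_eq_abs, mul_comm (v - t),
    abs_of_nonneg this.1]
  refine this.2.trans ((le_abs_self _).trans ?_)
  rw [abs_mul]
  gcongr

theorem huberScore_eq (t : ℝ) : huberScore t = trunc t := (hasDerivAt_huber t).deriv

/-- For `|t| ≤ 1/2` both `u` and `u - t` lie in the quadratic zone. For larger `|t|` the slope is
frozen at `u ∓ 1/2`, the last one sure to be admissible, and the gain stays at least `1/8`. -/
theorem huber_quadratic_lower {u : ℝ} (hu : |u| ≤ 1 / 2) (t : ℝ) :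
    huber u - trunc u * t + min (t ^ 2) (1 / 4) / 2 ≤ huber (u - t) := by
  have hu' := abs_le.1 hu
  have hu1 : |u| ≤ 1 := by linarith
  rw [huber_eq u, trunc_eq_self hu1]
  rcases le_or_gt |t| (1 / 2) with ht | ht
  · have ht' := abs_le.1 ht
    have h1 : |u - t| ≤ 1 := by rw [abs_le]; constructor <;> linarith
    have := le_huber h1 (u - t)
    have := min_le_left (t ^ 2) (1 / 4)
    nlinarith
  · have := min_le_right (t ^ 2) (1 / 4)
    rcases le_or_gt 0 t with h0 | h0
    · rw [abs_of_nonneg h0] at ht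
      have := le_huber (c := u - 1 / 2) (by rw [abs_le]; constructor <;> linarith) (u - t)
      nlinarith
    · rw [abs_of_neg h0] at ht
      have := le_huber (c := u + 1 / 2) (by rw [abs_le]; constructor <;> linarith) (u - t)
      nlinarith

theorem measurable_trunc : Measurable trunc := continuous_trunc.measurable

/-! ### Clipping errors, with `r` the inverse of the clipping level. -/

/-- Clipping of a real number at level `τ`. -/
def clip (τ a : ℝ) : ℝ := Real.sign a * min |a| τ

theorem clip_of_abs_le {τ a : ℝ} (h : |a| ≤ τ) : clip τ a = a := by
  rw [clip, min_eq_left h]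
  rcases lt_trichotomy a 0 with ha | rfl | ha
  · rw [Real.sign_of_neg ha, abs_of_neg ha]; ring
  · simp
  · rw [Real.sign_of_pos ha, abs_of_pos ha]; ring

theorem abs_clip_le_abs {τ : ℝ} (hτ : 0 ≤ τ) (a : ℝ) : |clip τ a| ≤ |a| := by
  rcases eq_or_ne a 0 with rfl | ha
  · simp [clip]
  · rw [clip, abs_mul, abs_of_nonneg (le_min (abs_nonneg a) hτ)]
    have : |Real.sign a| = 1 := by
      rcases Real.sign_apply_eq_of_ne_zero a ha with h | h <;> simp [h]
    rw [this, one_mul]; exact min_le_left _ _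

theorem abs_clip_le {τ : ℝ} (hτ : 0 ≤ τ) (a : ℝ) : |clip τ a| ≤ τ := by
  rcases eq_or_ne a 0 with rfl | ha
  · simpa [clip] using hτ
  · rw [clip, abs_mul, abs_of_nonneg (le_min (abs_nonneg a) hτ)]
    have : |Real.sign a| = 1 := by
      rcases Real.sign_apply_eq_of_ne_zero a ha with h | h <;> simp [h]
    rw [this, one_mul]; exact min_le_right _ _

theorem abs_sub_clip_le {τ : ℝ} (hτ : 0 ≤ τ) (a : ℝ) : |a - clip τ a| ≤ |a| := by
  rcases lt_trichotomy a 0 with ha | rfl | ha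
  · rw [clip, Real.sign_of_neg ha, abs_of_neg ha, abs_le]
    have := min_le_left (-a) τ
    have : 0 ≤ min (-a) τ := le_min (by linarith) hτ
    constructor <;> linarith
  · simp [clip]
  · rw [clip, Real.sign_of_pos ha, abs_of_pos ha, abs_le]
    have := min_le_left a τ
    have : 0 ≤ min a τ := le_min ha.le hτ
    constructor <;> linarith

theorem measurable_clip (τ : ℝ) : Measurable (clip τ) := by
  have : clip τ = fun a => if a < 0 then -(min |a| τ) else if 0 < a then min |a| τ else 0 := by
    funext a
    unfold clip Real.sign
    split_ifs <;> ring
  rw [this]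
  refine Measurable.ite measurableSet_Iio (by fun_prop) ?_
  exact Measurable.ite measurableSet_Ioi (by fun_prop) measurable_const

/-- If `r * τ = 1` then the clipping error is at most `r * a²`. -/
theorem abs_sub_clip_le_sq {τ r : ℝ} (hr : 0 < r) (hrτ : r * τ = 1) (a : ℝ) :
    |a - clip τ a| ≤ r * a ^ 2 := by
  have hτ : 0 < τ := pos_of_mul_pos_right (by rw [hrτ]; norm_num) hr.le
  rcases le_or_gt |a| τ with h | h
  · rw [clip_of_abs_le h]; simp; positivity
  · refine (abs_sub_clip_le hτ.le a).trans ?_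
    have : 1 ≤ r * |a| := by rw [← hrτ]; gcongr
    rw [← sq_abs]; nlinarith [abs_nonneg a]

/-- This is the source of the Markov-type bounds: on the clipping event any power of `r * |a|` may
be inserted as a factor, and fourth moments allow up to the fourth. -/
theorem one_le_of_clip_ne {τ r : ℝ} (hr : 0 < r) (hrτ : r * τ = 1) {a : ℝ} (h : clip τ a ≠ a) :
    1 ≤ r * |a| := by
  have : τ < |a| := by
    by_contra hc
    exact h (clip_of_abs_le (not_lt.1 hc))
  rw [← hrτ]; gcongr

theorem abs_sub_clip_le_pow_four {τ r : ℝ} (hr : 0 < r) (hrτ : r * τ = 1) (a : ℝ) :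
    |a - clip τ a| ≤ r ^ 3 * a ^ 4 := by
  have hτ : 0 < τ := pos_of_mul_pos_right (by rw [hrτ]; norm_num) hr.le
  by_cases h : clip τ a = a
  · rw [h]; simp; positivity
  · refine (abs_sub_clip_le hτ.le a).trans ?_
    have h1 := one_le_of_clip_ne hr hrτ h
    have h2 : 1 ≤ (r * |a|) ^ 3 := one_le_pow₀ h1
    have h3 : a ^ 4 = |a| ^ 4 := by rw [pow_abs, abs_of_nonneg (by positivity)]
    rw [h3]
    calc |a| = 1 * |a| := by ring
      _ ≤ (r * |a|) ^ 3 * |a| := by gcongr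
      _ = _ := by ring

theorem one_le_pow_four_of_clip_ne {τ r : ℝ} (hr : 0 < r) (hrτ : r * τ = 1) {a : ℝ}
    (h : clip τ a ≠ a) : 1 ≤ r ^ 4 * a ^ 4 := by
  have h2 : 1 ≤ (r * |a|) ^ 4 := one_le_pow₀ (one_le_of_clip_ne hr hrτ h)
  rwa [mul_pow, pow_abs, abs_of_nonneg (by positivity : 0 ≤ a ^ 4)] at h2

/-- This is `a² ≤ 2b² + 2(a - b)²`, stable under a cap. It moves a capped square to a nearby
argument. -/
theorem half_min_sq_le (a b M : ℝ) (hM : 0 ≤ M) : min (a ^ 2) M / 2 - (a - b) ^ 2 ≤ min (b ^ 2) M := by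
  rcases le_total (b ^ 2) M with h | h
  · rw [min_eq_left h]
    have := min_le_left (a ^ 2) M
    nlinarith [sq_nonneg (a - 2 * b)]
  · rw [min_eq_right h]
    have := min_le_right (a ^ 2) M
    nlinarith [sq_nonneg (a - b)]

/-! ### Sparse approximation in the `ℓ₁` ball. -/

/-- Maurey's empirical method, derandomized: a point of a polytope is approximated, in a
positive semidefinite form, by an average of `m` vertices. -/
theorem exists_sum_sub_le {E V : Type*} [AddCommGroup E] [Module ℝ E] [Fintype V]
    (B : LinearMap.BilinForm ℝ E) (hsymm : ∀ u v, B u v = B v u) (hnn : ∀ v, 0 ≤ B v v)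
    (f : V → E) (w : V → ℝ) (hw0 : ∀ v, 0 ≤ w v) (hw1 : ∑ v, w v = 1) {θ : E}
    (hθ : ∑ v, w v • f v = θ) {C : ℝ} (hC : ∀ v, B (f v) (f v) ≤ C) (m : ℕ) :
    ∃ g : Fin m → V, B (∑ k, (f (g k) - θ)) (∑ k, (f (g k) - θ)) ≤ m * C := by
  induction m with
  | zero => exact ⟨Fin.elim0, by simp⟩
  | succ m ih =>
    obtain ⟨g, hg⟩ := ih
    set T := ∑ k, (f (g k) - θ) with hT
    -- Under the weights `w` a vertex has mean `θ`, so the cross term averages to zero and the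
    -- square grows on average by a variance of at most `C`. Some vertex does no worse than the
    -- average.
    have hcross : ∑ v, w v * B T (f v - θ) = 0 := by
      have : ∑ v, w v • (f v - θ) = 0 := by
        simp only [smul_sub, Finset.sum_sub_distrib, hθ, ← Finset.sum_smul, hw1, one_smul, sub_self]
      calc _ = B T (∑ v, w v • (f v - θ)) := by simp [map_sum]
        _ = 0 := by rw [this, map_zero]
    have hself : ∑ v, w v * B (f v - θ) (f v - θ) ≤ C := by
      have h1 : ∀ v, w v * B (f v - θ) (f v - θ)
          = w v * B (f v) (f v) - 2 * (w v * B θ (f v)) + w v * B θ θ := fun v => by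
        simp only [map_sub, LinearMap.sub_apply]; rw [hsymm (f v) θ]; ring
      have h2 : ∑ v, w v * B θ (f v) = B θ θ := by
        conv_rhs => rw [← hθ, hθ]
        calc _ = B θ (∑ v, w v • f v) := by simp [map_sum]
          _ = _ := by rw [hθ]
      have h3 : ∑ v, w v * B (f v) (f v) ≤ C := by
        calc _ ≤ ∑ v, w v * C := Finset.sum_le_sum fun v _ =>
              mul_le_mul_of_nonneg_left (hC v) (hw0 v)
          _ = C := by rw [← Finset.sum_mul, hw1, one_mul]
      simp only [h1, Finset.sum_add_distrib, Finset.sum_sub_distrib, ← Finset.mul_sum, h2,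
        ← Finset.sum_mul, hw1]
      have := hnn θ
      linarith
    have hex : ∃ v, 2 * B T (f v - θ) + B (f v - θ) (f v - θ) ≤ C := by
      by_contra! hcon
      have h1 : ∑ v, w v * C < ∑ v, w v * (2 * B T (f v - θ) + B (f v - θ) (f v - θ)) := by
        obtain ⟨v, -, hv⟩ : ∃ v ∈ Finset.univ, 0 < w v :=
          (Finset.sum_pos_iff_of_nonneg fun v _ => hw0 v).1 (by rw [hw1]; norm_num)
        exact Finset.sum_lt_sum (fun v _ => mul_le_mul_of_nonneg_left (hcon v).le (hw0 v))
          ⟨v, Finset.mem_univ v, mul_lt_mul_of_pos_left (hcon v) hv⟩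
      have h2 : ∑ v, w v * (2 * B T (f v - θ) + B (f v - θ) (f v - θ))
          = 2 * ∑ v, w v * B T (f v - θ) + ∑ v, w v * B (f v - θ) (f v - θ) := by
        rw [Finset.mul_sum, ← Finset.sum_add_distrib]
        exact Finset.sum_congr rfl fun v _ => by ring
      rw [h2, hcross, ← Finset.sum_mul, hw1] at h1
      linarith
    obtain ⟨v, hv⟩ := hex
    refine ⟨Fin.snoc g v, ?_⟩
    have : ∑ k : Fin (m + 1), (f ((Fin.snoc g v : Fin (m + 1) → V) k) - θ) = T + (f v - θ) := by
      rw [Fin.sum_univ_castSucc]; simp [hT]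
    rw [this]
    simp only [map_add, LinearMap.add_apply]
    rw [hsymm (f v - θ) T]
    push_cast
    linarith

/-- The vertices `±R eⱼ` of the `ℓ₁` ball of radius `R`. -/
def crossVertex {d : ℕ} (R : ℝ) (p : Fin d × Bool) : EuclideanSpace ℝ (Fin d) :=
  (if p.2 then R else -R) • EuclideanSpace.single p.1 1

/-- The average of `m` vertices of the `ℓ₁` ball of radius `R`. -/
def crossAverage {d m : ℕ} (R : ℝ) (g : Fin m → Fin d × Bool) : EuclideanSpace ℝ (Fin d) :=
  (m : ℝ)⁻¹ • ∑ k, crossVertex R (g k)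

/-- The positive and negative parts of `θ j` over `R` give the weights of the two vertices on axis
`j`. The missing mass is spread evenly over all `2d` vertices, where antipodal pairs cancel. -/
theorem exists_crossVertex_weights {d : ℕ} (hd : 0 < d) {R : ℝ} (hR : 0 < R)
    {θ : EuclideanSpace ℝ (Fin d)} (hθ : l1Norm θ ≤ R) :
    ∃ w : Fin d × Bool → ℝ, (∀ p, 0 ≤ w p) ∧ ∑ p, w p = 1 ∧
      ∑ p, w p • crossVertex R p = θ := by
  have hd' : (0 : ℝ) < d := by exact_mod_cast hd
  refine ⟨fun p => (|θ p.1| + (if p.2 then θ p.1 else -θ p.1)) / (2 * R)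
    + (R - l1Norm θ) / (2 * d * R), fun p => ?_, ?_, ?_⟩
  · have h1 := neg_abs_le (θ p.1)
    have h2 := le_abs_self (θ p.1)
    have h3 : 0 ≤ R - l1Norm θ := by linarith
    have : 0 ≤ |θ p.1| + (if p.2 then θ p.1 else -θ p.1) := by split_ifs <;> linarith
    positivity
  · rw [Fintype.sum_prod_type]
    simp only [Fintype.sum_bool, if_true, Bool.false_eq_true, if_false]
    have : ∀ j : Fin d, (|θ j| + θ j) / (2 * R) + (R - l1Norm θ) / (2 * d * R)
        + ((|θ j| + -θ j) / (2 * R) + (R - l1Norm θ) / (2 * d * R))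
        = |θ j| / R + (R - l1Norm θ) / (d * R) := fun j => by field_simp; ring
    simp only [this, Finset.sum_add_distrib, ← Finset.sum_div, Finset.sum_const,
      Finset.card_univ, Fintype.card_fin, nsmul_eq_mul]
    change l1Norm θ / R + _ = 1
    field_simp; ring
  · rw [Fintype.sum_prod_type]
    simp only [Fintype.sum_bool, if_true, Bool.false_eq_true, if_false, crossVertex, smul_smul,
      ← add_smul]
    have : ∀ j : Fin d, ((|θ j| + θ j) / (2 * R) + (R - l1Norm θ) / (2 * d * R)) * R
        + ((|θ j| + -θ j) / (2 * R) + (R - l1Norm θ) / (2 * d * R)) * -R = θ j := fun j => by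
      field_simp; ring
    simp only [this]
    ext k
    simp [Finset.sum_apply, Pi.single_apply]

/-- Sparse approximation of points of the `ℓ₁` ball. -/
theorem exists_crossAverage_sub_le {d m : ℕ} (hd : 0 < d) (hm : 0 < m) {R : ℝ} (hR : 0 < R)
    {θ : EuclideanSpace ℝ (Fin d)} (hθ : l1Norm θ ≤ R)
    (B : LinearMap.BilinForm ℝ (EuclideanSpace ℝ (Fin d)))
    (hsymm : ∀ u v, B u v = B v u) (hnn : ∀ v, 0 ≤ B v v) {C : ℝ}
    (hC : ∀ j, B (EuclideanSpace.single j 1) (EuclideanSpace.single j 1) ≤ C) :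
    ∃ g : Fin m → Fin d × Bool,
      B (crossAverage R g - θ) (crossAverage R g - θ) ≤ R ^ 2 * C / m := by
  obtain ⟨w, hw0, hw1, hw⟩ := exists_crossVertex_weights hd hR hθ
  have hC' : ∀ p : Fin d × Bool, B (crossVertex R p) (crossVertex R p) ≤ R ^ 2 * C := fun p => by
    have := hC p.1
    simp only [crossVertex, map_smul, LinearMap.smul_apply, smul_eq_mul]
    rw [← mul_assoc]
    have h : (if p.2 then R else -R) * (if p.2 then R else -R) = R ^ 2 := by split_ifs <;> ring
    rw [h]; gcongr
  obtain ⟨g, hg⟩ := exists_sum_sub_le B hsymm hnn (crossVertex R) w hw0 hw1 hw hC' m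
  have hm' : (0 : ℝ) < m := by exact_mod_cast hm
  refine ⟨g, ?_⟩
  have : crossAverage R g - θ = (m : ℝ)⁻¹ • ∑ k, (crossVertex R (g k) - θ) := by
    rw [Finset.sum_sub_distrib, smul_sub, crossAverage]
    simp only [Finset.sum_const, Finset.card_univ, Fintype.card_fin]
    rw [← Nat.cast_smul_eq_nsmul ℝ, smul_smul, inv_mul_cancel₀ hm'.ne', one_smul]
  rw [this]
  simp only [map_smul, LinearMap.smul_apply, smul_eq_mul]
  calc _ ≤ (m : ℝ)⁻¹ * ((m : ℝ)⁻¹ * (m * (R ^ 2 * C))) := by gcongr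
    _ = _ := by field_simp

/-! ### Norms on coordinate subsets and the restricted eigenvalue cone. -/

theorem l1Norm_nonneg {d : ℕ} (v : EuclideanSpace ℝ (Fin d)) : 0 ≤ l1Norm v :=
  Finset.sum_nonneg fun _ _ => abs_nonneg _

theorem l1Norm_restrict {d : ℕ} (v : EuclideanSpace ℝ (Fin d)) (J : Finset (Fin d)) :
    l1Norm (restrict v J) = ∑ j ∈ J, |v j| := by
  simp only [l1Norm, restrict, apply_ite abs, abs_zero]
  simp

theorem l1Norm_restrict_add {d : ℕ} (v : EuclideanSpace ℝ (Fin d)) (J : Finset (Fin d)) :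
    l1Norm (restrict v J) + l1Norm (restrict v Jᶜ) = l1Norm v := by
  rw [l1Norm_restrict, l1Norm_restrict, l1Norm, Finset.sum_add_sum_compl]

theorem norm_sq_restrict {d : ℕ} (v : EuclideanSpace ℝ (Fin d)) (J : Finset (Fin d)) :
    ‖restrict v J‖ ^ 2 = ∑ j ∈ J, (v j) ^ 2 := by
  rw [EuclideanSpace.norm_sq_eq]
  simp only [restrict, Real.norm_eq_abs, sq_abs]
  simp [ite_pow, Finset.sum_ite_mem]

theorem norm_sq_restrict_add {d : ℕ} (v : EuclideanSpace ℝ (Fin d)) (J : Finset (Fin d)) :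
    ‖restrict v J‖ ^ 2 + ‖restrict v Jᶜ‖ ^ 2 = ‖v‖ ^ 2 := by
  rw [norm_sq_restrict, norm_sq_restrict, Finset.sum_add_sum_compl, EuclideanSpace.norm_sq_eq]
  simp

theorem l1Norm_restrict_le {d : ℕ} (v : EuclideanSpace ℝ (Fin d)) (J : Finset (Fin d)) :
    l1Norm (restrict v J) ≤ √(J.card : ℝ) * ‖restrict v J‖ := by
  refine le_of_sq_le_sq ?_ (by positivity)
  rw [mul_pow, Real.sq_sqrt (by positivity), norm_sq_restrict, l1Norm_restrict]
  have := sq_sum_le_card_mul_sum_sq (s := J) (f := fun j => |v j|)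
  simpa using this

/-- The set of the `s` largest values of a function on `Fin d`. -/
theorem exists_largest {d s : ℕ} (hs : s ≤ d) (f : Fin d → ℝ) :
    ∃ T : Finset (Fin d), T.card = s ∧ ∀ j ∈ T, ∀ k ∉ T, f k ≤ f j := by
  obtain ⟨T, hT, hmax⟩ := Finset.exists_max_image
    (Finset.powersetCard s (Finset.univ : Finset (Fin d))) (fun T => ∑ j ∈ T, f j)
    (Finset.powersetCard_nonempty.2 (by simpa using hs))
  rw [Finset.mem_powersetCard] at hT
  refine ⟨T, hT.2, fun j hj k hk => ?_⟩
  have hk' : k ∉ T.erase j := fun h => hk (Finset.mem_of_mem_erase h)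
  -- Exchanging `j` for `k` cannot increase the maximal sum.
  have h := hmax (insert k (T.erase j)) (by
    rw [Finset.mem_powersetCard]
    refine ⟨Finset.subset_univ _, ?_⟩
    rw [Finset.card_insert_of_notMem hk', Finset.card_erase_of_mem hj, hT.2]
    have : 0 < T.card := Finset.card_pos.2 ⟨j, hj⟩
    omega)
  simp only [Finset.sum_insert hk'] at h
  have := Finset.add_sum_erase T f hj
  linarith

/-- A set of the `s` largest values carries at least as much mass as any other set of size at
most `s`. -/
theorem sum_le_sum_largest {d : ℕ} {f : Fin d → ℝ} (hf : ∀ j, 0 ≤ f j) {T J : Finset (Fin d)}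
    (hT : ∀ j ∈ T, ∀ k ∉ T, f k ≤ f j) (hJ : J.card ≤ T.card) :
    ∑ j ∈ J, f j ≤ ∑ j ∈ T, f j := by
  rw [← Finset.sum_inter_add_sum_sdiff J T, ← Finset.sum_inter_add_sum_sdiff T J,
    Finset.inter_comm T J]
  gcongr 1
  have hcard : (J \ T).card ≤ (T \ J).card := by
    have h1 := Finset.card_sdiff_add_card_inter J T
    have h2 := Finset.card_sdiff_add_card_inter T J
    rw [Finset.inter_comm] at h2
    omega
  -- An injection sends each index of `J` outside `T` to one of `T` outside `J`, where the value is
  -- at least as large.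
  obtain ⟨e⟩ : Nonempty ((J \ T : Finset (Fin d)) ↪ (T \ J : Finset (Fin d))) := by
    rw [Function.Embedding.nonempty_iff_card_le, Fintype.card_coe, Fintype.card_coe]
    exact hcard
  rw [← Finset.sum_coe_sort (J \ T), ← Finset.sum_coe_sort (T \ J)]
  calc ∑ i : (J \ T : Finset (Fin d)), f i ≤ ∑ i : (J \ T : Finset (Fin d)), f (e i) :=
        Finset.sum_le_sum fun i _ => hT _ (Finset.mem_sdiff.1 (e i).2).1 _
          (Finset.mem_sdiff.1 i.2).2
    _ = ∑ i ∈ Finset.univ.map e, f i := by rw [Finset.sum_map]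
    _ ≤ _ := Finset.sum_le_sum_of_subset_of_nonneg (Finset.subset_univ _) fun i _ _ => hf _

/-- On the cone `‖v_{Jᶜ}‖₁ ≤ c ‖v_J‖₁` the restricted eigenvalue condition bounds the whole
Euclidean norm. -/
theorem RestrictedEigenvalue.norm_le {d s : ℕ} {S : Matrix (Fin d) (Fin d) ℝ} {c κ : ℝ}
    (h : RestrictedEigenvalue S s c κ) (hs : 1 ≤ s) (hsd : s ≤ d)
    {v : EuclideanSpace ℝ (Fin d)} {J : Finset (Fin d)} (hJ : J.card ≤ s)
    (hv : l1Norm (restrict v Jᶜ) ≤ c * l1Norm (restrict v J)) :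
    κ * ‖v‖ ≤ (1 + c) * sqrtNorm S v := by
  obtain ⟨hc, hκ, hRE⟩ := h
  -- Passing from `J` to the `s` largest entries preserves the cone condition. Each entry off `T` is
  -- then at most the average over `T`, which bounds the Euclidean norm of the tail by that of the
  -- head.
  obtain ⟨T, hTc, hT⟩ := exists_largest hsd (fun j => |v j|)
  have hJT : l1Norm (restrict v J) ≤ l1Norm (restrict v T) := by
    rw [l1Norm_restrict, l1Norm_restrict]
    exact sum_le_sum_largest (fun j => abs_nonneg _) hT (by omega)
  have hcone : l1Norm (restrict v Tᶜ) ≤ c * l1Norm (restrict v T) := by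
    have h1 := l1Norm_restrict_add v J
    have h2 := l1Norm_restrict_add v T
    nlinarith
  have hRE' := hRE v T hTc.le hcone
  have hs' : (0 : ℝ) < s := by exact_mod_cast hs
  set a := l1Norm (restrict v T)
  have ha0 : 0 ≤ a := l1Norm_nonneg _
  have hpt : ∀ k ∈ Tᶜ, |v k| ≤ a / s := fun k hk => by
    rw [le_div_iff₀ hs', mul_comm, ← hTc, ← nsmul_eq_mul]
    have : a = ∑ j ∈ T, |v j| := l1Norm_restrict v T
    rw [this]
    exact Finset.card_nsmul_le_sum _ _ _ fun j hj => hT j hj k (Finset.mem_compl.1 hk)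
  have htail : ‖restrict v Tᶜ‖ ^ 2 ≤ c * ‖restrict v T‖ ^ 2 := by
    have h1 : ‖restrict v Tᶜ‖ ^ 2 ≤ a / s * l1Norm (restrict v Tᶜ) := by
      rw [norm_sq_restrict, l1Norm_restrict, Finset.mul_sum]
      refine Finset.sum_le_sum fun k hk => ?_
      rw [← sq_abs, sq]
      exact mul_le_mul_of_nonneg_right (hpt k hk) (abs_nonneg _)
    have h2 : a ^ 2 ≤ s * ‖restrict v T‖ ^ 2 := by
      have := pow_le_pow_left₀ ha0 (l1Norm_restrict_le v T) 2
      rwa [mul_pow, Real.sq_sqrt (by positivity), hTc] at this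
    calc _ ≤ a / s * (c * a) := h1.trans (by gcongr)
      _ = c * (a ^ 2 / s) := by ring
      _ ≤ _ := by
        gcongr
        rw [div_le_iff₀ hs']; linarith
  have hfull := norm_sq_restrict_add v T
  have : ‖v‖ ≤ (1 + c) * ‖restrict v T‖ := by
    refine le_of_sq_le_sq ?_ (by positivity)
    have := sq_nonneg ‖restrict v T‖
    nlinarith [mul_nonneg (mul_nonneg hc.le (by linarith : 0 ≤ 1 + c)) this]
  nlinarith

theorem RestrictedEigenvalue.l1Norm_restrict_le {d s : ℕ} {S : Matrix (Fin d) (Fin d) ℝ}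
    {c κ : ℝ} (h : RestrictedEigenvalue S s c κ)
    {v : EuclideanSpace ℝ (Fin d)} {J : Finset (Fin d)} (hJ : J.card ≤ s)
    (hv : l1Norm (restrict v Jᶜ) ≤ c * l1Norm (restrict v J)) :
    κ * l1Norm (restrict v J) ≤ √(s : ℝ) * sqrtNorm S v := by
  have h1 := h.2.2 v J hJ hv
  have h2 := SparseHuber.l1Norm_restrict_le v J
  have h3 : √(J.card : ℝ) ≤ √(s : ℝ) := Real.sqrt_le_sqrt (by exact_mod_cast hJ)
  have hκ := h.2.1
  calc _ ≤ κ * (√(s : ℝ) * ‖restrict v J‖) := by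
        gcongr; exact h2.trans (by gcongr)
    _ = √(s : ℝ) * (κ * ‖restrict v J‖) := by ring
    _ ≤ _ := by gcongr

theorem sqrtNorm_smul {d : ℕ} (S : Matrix (Fin d) (Fin d) ℝ) (a : ℝ)
    (v : EuclideanSpace ℝ (Fin d)) : sqrtNorm S (a • v) = |a| * sqrtNorm S v := by
  rw [sqrtNorm, map_smul, norm_smul, Real.norm_eq_abs, sqrtNorm]

theorem norm_le_l1Norm {d : ℕ} (v : EuclideanSpace ℝ (Fin d)) : ‖v‖ ≤ l1Norm v := by
  refine le_of_sq_le_sq ?_ (l1Norm_nonneg v)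
  rw [EuclideanSpace.norm_sq_eq, l1Norm]
  exact Finset.sum_sq_le_sq_sum_of_nonneg fun _ _ => abs_nonneg _

theorem continuous_l1Norm {d : ℕ} : Continuous (l1Norm (d := d)) := by
  unfold l1Norm; fun_prop

/-! ### Existence of minimizers and the deterministic error bound. -/

theorem penalizedHuberRegression_nonempty {n d : ℕ} (y : Fin n → ℝ)
    (X : Fin n → EuclideanSpace ℝ (Fin d)) (lamO : ℝ) {lamS : ℝ} (hS : 0 < lamS) :
    (penalizedHuberRegression y X lamO lamS).Nonempty := by
  have hcont : Continuous (huberObjective y X lamO lamS) := by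
    unfold huberObjective
    have h1 := continuous_huber
    have h2 := continuous_l1Norm (d := d)
    fun_prop
  obtain ⟨β, hβ⟩ := hcont.exists_forall_le <| by
    refine Filter.tendsto_atTop_mono (f := fun β => lamS * ‖β‖) (fun β => ?_)
      ((tendsto_norm_cocompact_atTop).const_mul_atTop hS)
    have h1 : 0 ≤ ∑ i, lamO ^ 2 * huber ((y i - inner ℝ (X i) β) / (lamO * √(n : ℝ))) :=
      Finset.sum_nonneg fun i _ => mul_nonneg (sq_nonneg _) (huber_nonneg _)
    have h2 := mul_le_mul_of_nonneg_left (norm_le_l1Norm β) hS.le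
    unfold huberObjective; linarith
  exact ⟨β, fun v _ => hβ v⟩

theorem convexOn_huberObjective {n d : ℕ} (y : Fin n → ℝ)
    (X : Fin n → EuclideanSpace ℝ (Fin d)) (lamO : ℝ) {lamS : ℝ} (hS : 0 ≤ lamS) :
    ConvexOn ℝ Set.univ (huberObjective y X lamO lamS) := by
  refine ⟨convex_univ, fun u _ v _ a b ha hb hab => ?_⟩
  have h1 : l1Norm (a • u + b • v) ≤ a * l1Norm u + b * l1Norm v := by
    unfold l1Norm
    rw [Finset.mul_sum, Finset.mul_sum, ← Finset.sum_add_distrib]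
    refine Finset.sum_le_sum fun j _ => ?_
    simp only [PiLp.add_apply, PiLp.smul_apply, smul_eq_mul]
    refine (abs_add_le _ _).trans ?_
    rw [abs_mul, abs_mul, abs_of_nonneg ha, abs_of_nonneg hb]
  have h2 : ∀ i, huber ((y i - inner ℝ (X i) (a • u + b • v)) / (lamO * √(n : ℝ)))
      ≤ a * huber ((y i - inner ℝ (X i) u) / (lamO * √(n : ℝ)))
        + b * huber ((y i - inner ℝ (X i) v) / (lamO * √(n : ℝ))) := fun i => by
    have := convexOn_huber.2 (Set.mem_univ ((y i - inner ℝ (X i) u) / (lamO * √(n : ℝ))))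
      (Set.mem_univ ((y i - inner ℝ (X i) v) / (lamO * √(n : ℝ)))) ha hb hab
    simp only [smul_eq_mul] at this
    refine le_of_eq_of_le (congrArg huber ?_) this
    rw [inner_add_right, inner_smul_right, inner_smul_right]
    have : y i = a * y i + b * y i := by rw [← add_mul, hab, one_mul]
    conv_lhs => rw [this]
    ring
  have h3 : ∑ i, lamO ^ 2 * huber ((y i - inner ℝ (X i) (a • u + b • v)) / (lamO * √(n : ℝ)))
      ≤ ∑ i, (a * (lamO ^ 2 * huber ((y i - inner ℝ (X i) u) / (lamO * √(n : ℝ))))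
        + b * (lamO ^ 2 * huber ((y i - inner ℝ (X i) v) / (lamO * √(n : ℝ))))) :=
    Finset.sum_le_sum fun i _ => by nlinarith [mul_le_mul_of_nonneg_left (h2 i) (sq_nonneg lamO)]
  simp only [huberObjective, smul_eq_mul]
  simp only [Finset.sum_add_distrib, ← Finset.mul_sum] at h3 ⊢
  nlinarith [mul_le_mul_of_nonneg_left h1 hS]

/-- The truncated squared prediction at an observation with a small residual `u`. -/
def truncatedSq (u : ℝ) (Λ b : ℝ) : ℝ := if |u| ≤ 1 / 2 then min (b ^ 2) (Λ ^ 2 / 4) else 0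

theorem truncatedSq_nonneg (u Λ b : ℝ) : 0 ≤ truncatedSq u Λ b := by
  unfold truncatedSq; split_ifs <;> positivity

theorem truncatedSq_le (u Λ b : ℝ) : truncatedSq u Λ b ≤ Λ ^ 2 / 4 := by
  unfold truncatedSq; split_ifs
  · exact min_le_right _ _
  · positivity

/-- Rescaled curvature bound: a small residual contributes the capped square, any other residual
only its tangent. -/
theorem huber_sub_lower (u : ℝ) {Λ : ℝ} (hΛ : 0 < Λ) (b : ℝ) :
    Λ ^ 2 * huber u - Λ * (trunc u * b) + truncatedSq u Λ b / 2 ≤ Λ ^ 2 * huber (u - b / Λ) := by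
  unfold truncatedSq
  split_ifs with h
  · have h1 := mul_le_mul_of_nonneg_left (huber_quadratic_lower h (b / Λ)) (sq_nonneg Λ)
    have h2 : Λ ^ 2 * min ((b / Λ) ^ 2) (1 / 4) = min (b ^ 2) (Λ ^ 2 / 4) := by
      rw [mul_min_of_nonneg _ _ (sq_nonneg Λ)]; congr 1 <;> field_simp
    have h3 : Λ ^ 2 * (trunc u * (b / Λ)) = Λ * (trunc u * b) := by field_simp
    linarith
  · have h1 := mul_le_mul_of_nonneg_left (huber_tangent u (u - b / Λ)) (sq_nonneg Λ)
    have h3 : Λ ^ 2 * (trunc u * (b / Λ)) = Λ * (trunc u * b) := by field_simp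
    linarith

/-- Decomposability of the `ℓ₁` norm: off the support of `β` the perturbation is paid in full, on
the support it can save at most its own norm. -/
theorem l1Norm_add_lower {d : ℕ} (β θ : EuclideanSpace ℝ (Fin d)) :
    l1Norm β + l1Norm (restrict θ (Finset.univ.filter fun j => β j ≠ 0)ᶜ)
      - l1Norm (restrict θ (Finset.univ.filter fun j => β j ≠ 0)) ≤ l1Norm (β + θ) := by
  set J := Finset.univ.filter fun j => β j ≠ 0
  rw [l1Norm_restrict, l1Norm_restrict, l1Norm, l1Norm, ← Finset.sum_add_sum_compl J,
    ← Finset.sum_add_sum_compl J (fun j => |(β + θ) j|)]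
  have h1 : ∑ j ∈ J, |β j| - ∑ j ∈ J, |θ j| ≤ ∑ j ∈ J, |(β + θ) j| := by
    rw [← Finset.sum_sub_distrib]
    refine Finset.sum_le_sum fun j _ => ?_
    have := abs_sub_abs_le_abs_sub (β j) (-θ j)
    simpa using this
  have h0 : ∀ j ∈ Jᶜ, β j = 0 := fun j hj => by simpa [J] using hj
  have h2 : ∑ j ∈ Jᶜ, |β j| = 0 := Finset.sum_eq_zero fun j hj => by rw [h0 j hj, abs_zero]
  have h3 : ∑ j ∈ Jᶜ, |(β + θ) j| = ∑ j ∈ Jᶜ, |θ j| :=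
    Finset.sum_congr rfl fun j hj => by simp [h0 j hj]
  linarith

theorem abs_sum_mul_inner_le {n d : ℕ} (X : Fin n → EuclideanSpace ℝ (Fin d)) (c : Fin n → ℝ)
    (θ : EuclideanSpace ℝ (Fin d)) {G : ℝ} (hG : ∀ j, |∑ i, c i * X i j| ≤ G) :
    |∑ i, c i * inner ℝ (X i) θ| ≤ G * l1Norm θ := by
  have : ∑ i, c i * inner ℝ (X i) θ = ∑ j, θ j * ∑ i, c i * X i j := by
    simp only [PiLp.inner_apply, RCLike.inner_apply, conj_trivial, Finset.mul_sum]
    rw [Finset.sum_comm]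
    exact Finset.sum_congr rfl fun j _ => Finset.sum_congr rfl fun i _ => by ring
  rw [this, l1Norm, Finset.mul_sum]
  refine (Finset.abs_sum_le_sum_abs _ _).trans (Finset.sum_le_sum fun j _ => ?_)
  rw [abs_mul, mul_comm]
  exact mul_le_mul_of_nonneg_right (hG j) (abs_nonneg _)

/-- Deterministic part of the analysis: a bound on the gradient at `βstar` and restricted strong
convexity on a sphere bound the error of every minimizer. -/
theorem error_bound_of_gradient_of_curvature {n d s : ℕ} (hn : 0 < n) (hs : 1 ≤ s) (hsd : s ≤ d)
    {y : Fin n → ℝ} {X : Fin n → EuclideanSpace ℝ (Fin d)} {lamO lamS : ℝ} (hO : 0 < lamO)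
    (hS : 0 < lamS) {βstar βhat : EuclideanSpace ℝ (Fin d)} (hβ : l0Norm βstar ≤ s)
    {S : Matrix (Fin d) (Fin d) ℝ} {c κ : ℝ} (hRE : RestrictedEigenvalue S s c κ)
    {u : Fin n → ℝ} (hu : ∀ i, u i = (y i - inner ℝ (X i) βstar) / (lamO * √(n : ℝ)))
    {γ : ℝ} (hγ : γ * (c + 1) ≤ lamS * (c - 1))
    (hgrad : ∀ j, |∑ i, trunc (u i) * X i j| ≤ n * (γ / (lamO * √(n : ℝ))))
    {r : ℝ} (hr : 0 < r)
    (hcurv : ∀ θ : EuclideanSpace ℝ (Fin d), sqrtNorm S θ = r →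
      κ * l1Norm θ ≤ (1 + c) * (√(s : ℝ) * r) →
      n * (4 * lamS * (√(s : ℝ) * r) / κ)
        < ∑ i, truncatedSq (u i) (lamO * √(n : ℝ)) (inner ℝ (X i) θ))
    (hmin : βhat ∈ penalizedHuberRegression y X lamO lamS) :
    sqrtNorm S (βhat - βstar) ≤ r ∧ κ * l1Norm (βhat - βstar) ≤ (1 + c) * (√(s : ℝ) * r) ∧
      κ * ‖βhat - βstar‖ ≤ (1 + c) * r := by
  have hn' : (0 : ℝ) < n := by exact_mod_cast hn
  have hc := hRE.1
  have hκ := hRE.2.1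
  set Λ := lamO * √(n : ℝ) with hΛdef
  have hΛ : 0 < Λ := by positivity
  have hΛsq : Λ ^ 2 = lamO ^ 2 * n := by rw [hΛdef, mul_pow, Real.sq_sqrt hn'.le]
  set J := Finset.univ.filter fun j => βstar j ≠ 0 with hJ
  have hJs : J.card ≤ s := hβ
  -- Basic inequality, for every perturbation that does not raise the objective: it is used for the
  -- true error and for its rescaling.
  have excess : ∀ θ, huberObjective y X lamO lamS (βstar + θ) ≤ huberObjective y X lamO lamS βstar →
      lamS * l1Norm (restrict θ Jᶜ) + (∑ i, truncatedSq (u i) Λ (inner ℝ (X i) θ)) / (2 * n)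
        ≤ lamS * l1Norm (restrict θ J) + γ * l1Norm θ := fun θ hθ => by
    have h1 : ∀ i, Λ ^ 2 * huber (u i) - Λ * (trunc (u i) * inner ℝ (X i) θ)
        + truncatedSq (u i) Λ (inner ℝ (X i) θ) / 2
        ≤ Λ ^ 2 * huber ((y i - inner ℝ (X i) (βstar + θ)) / Λ) := fun i => by
      have := huber_sub_lower (u i) hΛ (inner ℝ (X i) θ)
      have e : u i - inner ℝ (X i) θ / Λ = (y i - inner ℝ (X i) (βstar + θ)) / Λ := by
        rw [hu, inner_add_right]; ring
      rwa [e] at this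
    have h2 := Finset.sum_le_sum fun i (_ : i ∈ Finset.univ) => h1 i
    rw [Finset.sum_add_distrib, Finset.sum_sub_distrib, ← Finset.mul_sum, ← Finset.mul_sum,
      ← Finset.mul_sum, ← Finset.sum_div] at h2
    have h3 := (abs_le.1 (abs_sum_mul_inner_le X (fun i => trunc (u i)) θ hgrad)).2
    have h3' : Λ * ∑ i, trunc (u i) * inner ℝ (X i) θ ≤ n * (γ * l1Norm θ) := by
      calc _ ≤ Λ * (n * (γ / Λ) * l1Norm θ) := by gcongr
        _ = _ := by field_simp
    have h4 := l1Norm_add_lower βstar θ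
    rw [← hJ] at h4
    have h5 := mul_le_mul_of_nonneg_left h4 hS.le
    simp only [huberObjective, ← Finset.mul_sum] at hθ
    simp only [← hΛdef, ← hu] at hθ
    rw [hΛsq] at h2
    set A := ∑ i, huber ((y i - inner ℝ (X i) (βstar + θ)) / Λ)
    set A0 := ∑ i, huber (u i)
    set W := ∑ i, truncatedSq (u i) Λ (inner ℝ (X i) θ)
    have h6 : W / 2 ≤ n * (lamO ^ 2 * A - lamO ^ 2 * A0 + γ * l1Norm θ) := by linarith
    have h7 : W / (2 * n) ≤ lamO ^ 2 * A - lamO ^ 2 * A0 + γ * l1Norm θ := by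
      rw [div_le_iff₀ (by positivity)]; linarith
    linarith
  have hWnn : ∀ θ, 0 ≤ (∑ i, truncatedSq (u i) Λ (inner ℝ (X i) θ)) / (2 * n) := fun θ =>
    div_nonneg (Finset.sum_nonneg fun i _ => truncatedSq_nonneg _ _ _) (by positivity)
  have hcone : ∀ θ, huberObjective y X lamO lamS (βstar + θ) ≤ huberObjective y X lamO lamS βstar →
      l1Norm (restrict θ Jᶜ) ≤ c * l1Norm (restrict θ J) := fun θ hθ => by
    have h1 := excess θ hθ
    have h2 := hWnn θ
    have h3 := l1Norm_restrict_add θ J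
    have h4 := l1Norm_nonneg (restrict θ J)
    have h5 := l1Norm_nonneg (restrict θ Jᶜ)
    set a := l1Norm (restrict θ J)
    set b := l1Norm (restrict θ Jᶜ)
    -- The basic inequality reads `(lamS - γ) b ≤ (lamS + γ) a`; the assumption on `γ` says exactly
    -- that this ratio is at most `c`.
    have h6 : (c + 1) * (lamS * b) ≤ (c + 1) * (lamS * a) + lamS * (c - 1) * (a + b) := by
      have : γ * (c + 1) * (a + b) ≤ lamS * (c - 1) * (a + b) := by gcongr
      rw [← h3] at h1
      nlinarith
    have h7 : lamS * b ≤ lamS * (c * a) := by nlinarith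
    exact le_of_mul_le_mul_left h7 hS
  have hl1 : ∀ θ, l1Norm (restrict θ Jᶜ) ≤ c * l1Norm (restrict θ J) →
      κ * l1Norm θ ≤ (1 + c) * (√(s : ℝ) * sqrtNorm S θ) := fun θ hθ => by
    have h1 := hRE.l1Norm_restrict_le hJs hθ
    have h3 := l1Norm_restrict_add θ J
    nlinarith
  have hmin0 : huberObjective y X lamO lamS (βstar + (βhat - βstar))
      ≤ huberObjective y X lamO lamS βstar := by
    rw [add_sub_cancel]; exact hmin (Set.mem_univ _)
  have main : sqrtNorm S (βhat - βstar) ≤ r := by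
    by_contra! hlt
    set θ := βhat - βstar
    have hpos : 0 < sqrtNorm S θ := hr.trans hlt
    -- Shrink an overlong error to the sphere of radius `r`. By convexity the objective there is
    -- still at most its value at `βstar`, so the cone and basic inequalities apply and contradict
    -- the curvature.
    set η := r / sqrtNorm S θ with hη
    have hη0 : 0 < η := by positivity
    have hη1 : η ≤ 1 := by rw [hη, div_le_one hpos]; exact hlt.le
    have hsph : sqrtNorm S (η • θ) = r := by
      rw [sqrtNorm_smul, abs_of_pos hη0, hη]; field_simp
    have hobj : huberObjective y X lamO lamS (βstar + η • θ)
        ≤ huberObjective y X lamO lamS βstar := by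
      have h1 := (convexOn_huberObjective y X lamO hS.le).2 (Set.mem_univ (βstar + θ))
        (Set.mem_univ βstar) hη0.le (by linarith : 0 ≤ 1 - η) (by ring)
      have e : η • (βstar + θ) + (1 - η) • βstar = βstar + η • θ := by module
      rw [e, smul_eq_mul, smul_eq_mul] at h1
      nlinarith
    have hcone' := hcone _ hobj
    have hex := excess _ hobj
    have hc1 := hcurv (η • θ) hsph (by have := hl1 _ hcone'; rwa [hsph] at this)
    have hJ1 := hRE.l1Norm_restrict_le hJs hcone'
    rw [hsph] at hJ1
    have h3 := l1Norm_restrict_add (η • θ) J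
    have h4 := l1Norm_nonneg (restrict (η • θ) J)
    have h5 := l1Norm_nonneg (restrict (η • θ) Jᶜ)
    set a := l1Norm (restrict (η • θ) J)
    set b := l1Norm (restrict (η • θ) Jᶜ)
    have hγS : γ ≤ lamS := by
      have : γ * (c + 1) ≤ lamS * (c + 1) := by nlinarith
      exact le_of_mul_le_mul_right this (by linarith)
    have h6 : a ≤ √(s : ℝ) * r / κ := by rw [le_div_iff₀ hκ]; linarith
    set W := ∑ i, truncatedSq (u i) Λ (inner ℝ (X i) (η • θ))
    have h7 : W / (2 * n) ≤ 2 * lamS * a := by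
      rw [← h3] at hex
      nlinarith
    have h8 : 2 * (lamS * (√(s : ℝ) * r) / κ) < W / (2 * n) := by
      rw [lt_div_iff₀ (by positivity)]
      calc _ = n * (4 * lamS * (√(s : ℝ) * r) / κ) := by ring
        _ < W := hc1
    have h9 : 2 * lamS * a ≤ 2 * lamS * (√(s : ℝ) * r / κ) := by gcongr
    have h10 : 2 * lamS * (√(s : ℝ) * r / κ) = 2 * (lamS * (√(s : ℝ) * r) / κ) := by ring
    linarith
  have hcone0 := hcone _ hmin0
  refine ⟨main, (hl1 _ hcone0).trans (by gcongr), (hRE.norm_le hs hsd hJs hcone0).trans (by gcongr)⟩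

/-! ### An exponential tail bound, and moments of the covariates. -/

/-- Chernoff bound for a sum of independent bounded variables at exponent one. -/
theorem measureReal_sum_ge_le {Ω β : Type*} [MeasurableSpace Ω] [MeasurableSpace β]
    {μ : Measure Ω} [IsProbabilityMeasure μ]
    {n : ℕ} {p : Fin n → Ω → β} (hind : iIndepFun p μ) (hp : ∀ i, Measurable (p i))
    {φ : β → ℝ} (hφ : Measurable φ) (hb : ∀ z, |φ z| ≤ 1) {c : Fin n → ℝ}
    (hc : ∀ i, ∫ ω, φ (p i ω) ∂μ + ∫ ω, φ (p i ω) ^ 2 ∂μ ≤ c i) (a : ℝ) :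
    μ.real {ω | a ≤ ∑ i, φ (p i ω)} ≤ Real.exp (∑ i, c i - a) := by
  have hm : ∀ i, Measurable (fun ω => φ (p i ω)) := fun i => hφ.comp (hp i)
  have hind' : iIndepFun (fun i ω => φ (p i ω)) μ := hind.comp (fun _ => φ) fun _ => hφ
  have hint : ∀ i, Integrable (fun ω => φ (p i ω)) μ := fun i =>
    Integrable.of_bound (hm i).aestronglyMeasurable 1 (Filter.Eventually.of_forall fun ω => hb _)
  have hint2 : ∀ i, Integrable (fun ω => φ (p i ω) ^ 2) μ := fun i =>
    Integrable.of_bound ((hm i).pow_const 2).aestronglyMeasurable 1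
      (Filter.Eventually.of_forall fun ω => by
        rw [Real.norm_eq_abs, abs_pow]; exact pow_le_one₀ (abs_nonneg _) (hb _))
  have hmgf : ∀ i, mgf (fun ω => φ (p i ω)) μ 1 ≤ Real.exp (c i) := fun i => by
    calc mgf (fun ω => φ (p i ω)) μ 1
        ≤ ∫ ω, (1 + φ (p i ω) + φ (p i ω) ^ 2) ∂μ := by
          refine integral_mono_of_nonneg (Filter.Eventually.of_forall fun ω => (Real.exp_pos _).le)
            (((integrable_const _).add (hint i)).add (hint2 i))
            (Filter.Eventually.of_forall fun ω => ?_)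
          -- `eˣ ≤ 1 + x + x²` for `|x| ≤ 1`.
          have := (abs_le.1 (Real.abs_exp_sub_one_sub_id_le (hb (p i ω)))).2
          simp only [one_mul]
          linarith
      _ = 1 + (∫ ω, φ (p i ω) ∂μ + ∫ ω, φ (p i ω) ^ 2 ∂μ) := by
          have h1 : Integrable (fun ω => 1 + φ (p i ω)) μ := (integrable_const _).add (hint i)
          rw [integral_add h1 (hint2 i), integral_add (integrable_const _) (hint i)]
          simp; ring
      _ ≤ Real.exp (c i) := by
          have h1 := hc i
          have h2 := Real.add_one_le_exp (c i)
          linarith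
  have hsum : Measurable (fun ω => ∑ i, φ (p i ω)) := Finset.measurable_sum _ fun i _ => hm i
  have hexp : Integrable (fun ω => Real.exp (1 * ∑ i, φ (p i ω))) μ := by
    refine Integrable.of_bound (hsum.const_mul 1).exp.aestronglyMeasurable (Real.exp n) (Filter.Eventually.of_forall fun ω => ?_)
    rw [Real.norm_eq_abs, abs_of_pos (Real.exp_pos _), one_mul, Real.exp_le_exp]
    calc ∑ i, φ (p i ω) ≤ ∑ _i : Fin n, (1 : ℝ) :=
          Finset.sum_le_sum fun i _ => (le_abs_self _).trans (hb _)
      _ = n := by simp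
  have h1 := measure_ge_le_exp_mul_mgf a zero_le_one hexp
  have h2 : mgf (fun ω => ∑ i, φ (p i ω)) μ 1 ≤ Real.exp (∑ i, c i) := by
    have e : (fun ω => ∑ i, φ (p i ω)) = ∑ i, fun ω => φ (p i ω) := by
      funext ω; simp
    rw [e, hind'.mgf_sum hm, Real.exp_sum]
    exact Finset.prod_le_prod (fun i _ => mgf_nonneg) fun i _ => hmgf i
  calc _ ≤ Real.exp (-1 * a) * mgf (fun ω => ∑ i, φ (p i ω)) μ 1 := h1
    _ ≤ Real.exp (-1 * a) * Real.exp (∑ i, c i) := by gcongr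
    _ = _ := by rw [← Real.exp_add]; congr 1; ring

section Moments

variable {Ω : Type*} [MeasurableSpace Ω] {μ : Measure Ω} {d : ℕ}

theorem dotProduct_secondMoment {Z : Ω → EuclideanSpace ℝ (Fin d)}
    (hZ : ∀ j k, Integrable (fun ω => Z ω j * Z ω k) μ) (v : EuclideanSpace ℝ (Fin d)) :
    v.ofLp ⬝ᵥ (secondMoment μ Z).mulVec v.ofLp = ∫ ω, inner ℝ (Z ω) v ^ 2 ∂μ := by
  have h : ∀ ω, inner ℝ (Z ω) v ^ 2 = ∑ j, ∑ k, v j * v k * (Z ω j * Z ω k) := fun ω => by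
    simp only [PiLp.inner_apply, RCLike.inner_apply, conj_trivial, sq, Finset.sum_mul_sum]
    exact Finset.sum_congr rfl fun j _ => Finset.sum_congr rfl fun k _ => by ring
  simp only [h]
  rw [integral_finsetSum _ fun j _ => integrable_finsetSum _ fun k _ => (hZ j k).const_mul _]
  simp only [dotProduct, Matrix.mulVec, secondMoment, Matrix.of_apply, Finset.mul_sum]
  refine Finset.sum_congr rfl fun j _ => ?_
  rw [integral_finsetSum _ fun k _ => (hZ j k).const_mul _]
  exact Finset.sum_congr rfl fun k _ => by rw [integral_const_mul]; ring

theorem posSemidef_secondMoment {Z : Ω → EuclideanSpace ℝ (Fin d)}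
    (hZ : ∀ j k, Integrable (fun ω => Z ω j * Z ω k) μ) : (secondMoment μ Z).PosSemidef := by
  refine Matrix.PosSemidef.of_dotProduct_mulVec_nonneg ?_ fun v => ?_
  · ext j k
    simp [secondMoment, mul_comm]
  · have := dotProduct_secondMoment hZ (WithLp.toLp 2 v)
    rw [star_trivial]
    simp only at this
    rw [this]
    exact integral_nonneg fun ω => sq_nonneg _

variable {Z : Ω → EuclideanSpace ℝ (Fin d)}

theorem memLp_inner {p : ENNReal} (hZ : MemLp Z p μ) (v : EuclideanSpace ℝ (Fin d)) :
    MemLp (fun ω => inner ℝ (Z ω) v) p μ := by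
  simpa only [real_inner_comm] using hZ.const_inner (𝕜 := ℝ) v

theorem memLp_coord {p : ENNReal} (hZ : MemLp Z p μ) (j : Fin d) :
    MemLp (fun ω => Z ω j) p μ := by
  simpa only [EuclideanSpace.inner_single_right, one_mul, conj_trivial] using
    memLp_inner hZ (EuclideanSpace.single j 1)

theorem FiniteKurtosis.integral_inner_pow_four_le {K : ℝ} (h : FiniteKurtosis μ Z K)
    (h0 : ∫ ω, Z ω ∂μ = 0) (v : EuclideanSpace ℝ (Fin d)) :
    ∫ ω, inner ℝ (Z ω) v ^ 4 ∂μ ≤ K ^ 4 * (∫ ω, inner ℝ (Z ω) v ^ 2 ∂μ) ^ 2 := by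
  have := h.2 v
  simpa only [h0, sub_zero, real_inner_comm] using this

theorem FiniteKurtosis.integral_coord_pow_four_le {K : ℝ} (h : FiniteKurtosis μ Z K)
    (h0 : ∫ ω, Z ω ∂μ = 0) (h1 : ∀ j, ∫ ω, Z ω j ^ 2 ∂μ ≤ 1) (j : Fin d) :
    ∫ ω, Z ω j ^ 4 ∂μ ≤ K ^ 4 := by
  have h2 := h.integral_inner_pow_four_le h0 (EuclideanSpace.single j 1)
  simp only [EuclideanSpace.inner_single_right, one_mul, conj_trivial] at h2
  have h3 : 0 ≤ ∫ ω, Z ω j ^ 2 ∂μ := integral_nonneg fun ω => sq_nonneg _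
  have h4 : (∫ ω, Z ω j ^ 2 ∂μ) ^ 2 ≤ 1 := pow_le_one₀ h3 (h1 j)
  have h5 : 0 ≤ K ^ 4 := by positivity
  nlinarith

variable [IsProbabilityMeasure μ]

theorem integrable_pow_four {f : Ω → ℝ} (hf : MemLp f 4 μ) : Integrable (fun ω => f ω ^ 4) μ := by
  have := MemLp.integrable_norm_pow' (p := 4) (by exact_mod_cast hf)
  refine this.congr (Filter.Eventually.of_forall fun ω => ?_)
  simp only [Real.norm_eq_abs, pow_abs]
  exact abs_of_nonneg (by positivity)

theorem integrable_pow_two {f : Ω → ℝ} (hf : MemLp f 4 μ) : Integrable (fun ω => f ω ^ 2) μ :=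
  (hf.mono_exponent (by norm_num : (2 : ENNReal) ≤ 4)).integrable_sq

theorem integrable_coord_mul (hZ : MemLp Z 4 μ) (j k : Fin d) :
    Integrable (fun ω => Z ω j * Z ω k) μ :=
  ((memLp_coord hZ j).mono_exponent (by norm_num : (2 : ENNReal) ≤ 4)).integrable_mul
    ((memLp_coord hZ k).mono_exponent (by norm_num : (2 : ENNReal) ≤ 4))

/-- Integrate `(f² - m)² ≥ 0`, where `m` is the second moment. -/
theorem sq_integral_sq_le {f : Ω → ℝ} (hf : MemLp f 4 μ) :
    (∫ ω, f ω ^ 2 ∂μ) ^ 2 ≤ ∫ ω, f ω ^ 4 ∂μ := by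
  have h4 := integrable_pow_four hf
  have h2 := integrable_pow_two hf
  set m := ∫ ω, f ω ^ 2 ∂μ
  have : ∫ ω, (2 * m * f ω ^ 2 - m ^ 2) ∂μ ≤ ∫ ω, f ω ^ 4 ∂μ :=
    integral_mono ((h2.const_mul _).sub (integrable_const _)) h4 fun ω => by
      simp only
      nlinarith [sq_nonneg (f ω ^ 2 - m)]
  rw [integral_sub (h2.const_mul _) (integrable_const _), integral_const_mul] at this
  simp at this
  linarith

theorem sqrtNorm_sq_eq_integral (hZ : MemLp Z 4 μ) (v : EuclideanSpace ℝ (Fin d)) :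
    sqrtNorm (secondMoment μ Z) v ^ 2 = ∫ ω, inner ℝ (Z ω) v ^ 2 ∂μ := by
  rw [sqrtNorm_sq (posSemidef_secondMoment (integrable_coord_mul hZ)),
    dotProduct_secondMoment (integrable_coord_mul hZ)]

/-- The restricted eigenvalue and kurtosis constants of a vector with coordinate variances at
most one. -/
theorem RestrictedEigenvalue.kappa_le_one_and_one_le {s : ℕ} {c κ K : ℝ} (hs : 1 ≤ s) (hd : 0 < d)
    (hRE : RestrictedEigenvalue (secondMoment μ Z) s c κ) (h : FiniteKurtosis μ Z K)
    (h0 : ∫ ω, Z ω ∂μ = 0) (h1 : ∀ j, ∫ ω, Z ω j ^ 2 ∂μ ≤ 1) : κ ≤ 1 ∧ 1 ≤ K ^ 4 := by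
  obtain ⟨hc, hκ, hRE⟩ := hRE
  -- Test on one basis vector: its variance `m` satisfies `κ² ≤ m ≤ 1`, and `m² ≤ E Z_j⁴ ≤ K⁴ m²`
  -- with `m > 0`.
  let j : Fin d := ⟨0, hd⟩
  let e : EuclideanSpace ℝ (Fin d) := EuclideanSpace.single j 1
  have he : restrict e {j} = e := by
    ext k
    by_cases hk : k = j <;> simp [restrict, e, hk]
  have he' : l1Norm (restrict e {j}ᶜ) = 0 := by
    have := l1Norm_restrict_add e {j}
    rw [he] at this; linarith
  have h2 := hRE e {j} (by simpa using hs) (by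
    rw [he']; exact mul_nonneg hc.le (l1Norm_nonneg _))
  have hen : ‖e‖ = 1 := by simp [e]
  rw [he, hen, mul_one] at h2
  have h3 := sqrtNorm_sq_eq_integral h.1 e
  simp only [e, EuclideanSpace.inner_single_right, one_mul, conj_trivial] at h3
  set m := ∫ ω, Z ω j ^ 2 ∂μ
  have hm : κ ^ 2 ≤ m := by rw [← h3]; exact pow_le_pow_left₀ hκ.le h2 2
  have hm1 : m ≤ 1 := h1 j
  have hmpos : 0 < m := lt_of_lt_of_le (by positivity) hm
  have h4 := sq_integral_sq_le (memLp_coord h.1 j)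
  have h5 := h.integral_inner_pow_four_le h0 e
  simp only [e, EuclideanSpace.inner_single_right, one_mul, conj_trivial] at h5
  constructor
  · nlinarith
  · by_contra! hlt
    have : K ^ 4 * m ^ 2 < 1 * m ^ 2 := by gcongr
    linarith [h4.trans h5]

end Moments

/-! ### The clipped regression: pointwise bounds, score bias and mean curvature. -/

/-- Coordinatewise clipping of a vector. -/
def clipVec {d : ℕ} (τ : ℝ) (z : EuclideanSpace ℝ (Fin d)) : EuclideanSpace ℝ (Fin d) :=
  WithLp.toLp 2 fun j => clip τ (z j)

theorem clipVec_apply {d : ℕ} (τ : ℝ) (z : EuclideanSpace ℝ (Fin d)) (j : Fin d) :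
    clipVec τ z j = clip τ (z j) := rfl

theorem measurable_clipVec {d : ℕ} (τ : ℝ) : Measurable (clipVec (d := d) τ) := by
  refine (WithLp.measurable_toLp 2 _).comp (measurable_pi_iff.2 fun j => ?_)
  exact (measurable_clip τ).comp (by fun_prop)

/-- The normalized residual at `β` of the regression with clipped covariates. -/
def clippedResidual {d : ℕ} (τ Λ : ℝ) (β : EuclideanSpace ℝ (Fin d))
    (p : EuclideanSpace ℝ (Fin d) × ℝ) : ℝ :=
  (inner ℝ p.1 β + p.2 - inner ℝ (clipVec τ p.1) β) / Λ

theorem measurable_clippedResidual {d : ℕ} (τ Λ : ℝ) (β : EuclideanSpace ℝ (Fin d)) :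
    Measurable (clippedResidual τ Λ β) := by
  have := measurable_clipVec (d := d) τ
  unfold clippedResidual
  fun_prop

/-- Either the residual is the noise, or some coordinate in the support of `β` was clipped. -/
theorem clippedResidual_eq_or {d : ℕ} {τ r Λ : ℝ} (hr : 0 < r) (hrτ : r * τ = 1)
    (β : EuclideanSpace ℝ (Fin d)) (p : EuclideanSpace ℝ (Fin d) × ℝ) :
    clippedResidual τ Λ β p = p.2 / Λ ∨
      1 ≤ ∑ k ∈ Finset.univ.filter (fun j => β j ≠ 0), r ^ 4 * p.1 k ^ 4 := by
  by_cases h : ∀ k, β k ≠ 0 → clip τ (p.1 k) = p.1 k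
  · left
    have : inner ℝ (clipVec τ p.1) β = inner ℝ p.1 β := by
      simp only [PiLp.inner_apply, RCLike.inner_apply, conj_trivial, clipVec_apply]
      refine Finset.sum_congr rfl fun k _ => ?_
      by_cases hk : β k = 0
      · simp [hk]
      · rw [h k hk]
    rw [clippedResidual, this]; congr 1; ring
  · right
    push Not at h
    obtain ⟨k, hk, hne⟩ := h
    refine (one_le_pow_four_of_clip_ne hr hrτ hne).trans ?_
    exact Finset.single_le_sum (f := fun k => r ^ 4 * p.1 k ^ 4) (fun i _ => by positivity)
      (by simpa using hk)

/-- Pointwise lower bound for the truncated square by moments. -/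
theorem truncatedSq_clippedResidual_lower {d : ℕ} {τ r Λ t : ℝ} (hr : 0 < r) (hrτ : r * τ = 1)
    (hΛ : 0 < Λ) (ht : 0 < t)
    (β : EuclideanSpace ℝ (Fin d)) (p : EuclideanSpace ℝ (Fin d) × ℝ) (a b : ℝ) :
    a ^ 2 / 2 - t * a ^ 4 / 4
      - (1 / (4 * t)) * (2 * |p.2| / Λ
        + ∑ k ∈ Finset.univ.filter (fun j => β j ≠ 0), r ^ 4 * p.1 k ^ 4)
      - 2 * a ^ 4 / Λ ^ 2 - (a - b) ^ 2 ≤ truncatedSq (clippedResidual τ Λ β p) Λ b := by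
  set P := 2 * |p.2| / Λ + ∑ k ∈ Finset.univ.filter (fun j => β j ≠ 0), r ^ 4 * p.1 k ^ 4
  have hsum : 0 ≤ ∑ k ∈ Finset.univ.filter (fun j => β j ≠ 0), r ^ 4 * p.1 k ^ 4 :=
    Finset.sum_nonneg fun k _ => by positivity
  have hP : 0 ≤ P := by positivity
  have hP' : 0 ≤ 1 / (4 * t) * P := by positivity
  have h4 : 0 ≤ t * a ^ 4 / 4 := by positivity
  have h5 : 0 ≤ 2 * a ^ 4 / Λ ^ 2 := by positivity
  unfold truncatedSq
  split_ifs with hu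
  · have h1 := half_min_sq_le a b (Λ ^ 2 / 4) (by positivity)
    -- The cap costs only a fourth moment, by AM–GM on `Λ²/4` and `4a⁴/Λ²`.
    have h2 : a ^ 2 - 4 * a ^ 4 / Λ ^ 2 ≤ min (a ^ 2) (Λ ^ 2 / 4) := by
      refine le_min ?_ ?_
      · have : 0 ≤ 4 * a ^ 4 / Λ ^ 2 := by positivity
        linarith
      · rw [sub_le_iff_le_add]
        have e : Λ ^ 2 / 4 + 4 * a ^ 4 / Λ ^ 2 - a ^ 2
            = (Λ / 2 - 2 * a ^ 2 / Λ) ^ 2 + a ^ 2 := by field_simp; ring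
        nlinarith [sq_nonneg (Λ / 2 - 2 * a ^ 2 / Λ), sq_nonneg a]
    have h3 : 4 * a ^ 4 / Λ ^ 2 = 2 * (2 * a ^ 4 / Λ ^ 2) := by ring
    linarith
  · have h1 : 1 ≤ P := by
      rcases clippedResidual_eq_or (Λ := Λ) hr hrτ β p with h | h
      · rw [h, abs_div, abs_of_pos hΛ] at hu
        have : 2 * |p.2| / Λ = 2 * (|p.2| / Λ) := by ring
        push Not at hu
        linarith
      · have : 0 ≤ 2 * |p.2| / Λ := by positivity
        linarith
    have h2 : 1 / (4 * t) ≤ 1 / (4 * t) * P := le_mul_of_one_le_right (by positivity) h1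
    -- At a large residual the whole square is lost. Young's inequality with parameter `t` charges
    -- it to `a⁴` and to `P`, which is at least one there.
    have h3 : a ^ 2 / 2 ≤ t * a ^ 4 / 4 + 1 / (4 * t) := by
      have e : t * a ^ 4 / 4 + 1 / (4 * t) - a ^ 2 / 2 = (t * a ^ 2 - 1) ^ 2 / (4 * t) := by
        field_simp; ring
      have : 0 ≤ (t * a ^ 2 - 1) ^ 2 / (4 * t) := by positivity
      linarith
    nlinarith [sq_nonneg (a - b)]

theorem truncatedSq_half_le (u Λ a b : ℝ) :
    truncatedSq u Λ a / 2 - (a - b) ^ 2 ≤ truncatedSq u Λ b := by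
  unfold truncatedSq
  split_ifs
  · exact half_min_sq_le a b _ (by positivity)
  · nlinarith [sq_nonneg (a - b)]

theorem measurable_truncatedSq {α : Type*} [MeasurableSpace α] {u b : α → ℝ} (hu : Measurable u)
    (hb : Measurable b) (Λ : ℝ) : Measurable (fun z => truncatedSq (u z) Λ (b z)) := by
  unfold truncatedSq
  refine Measurable.ite (measurableSet_le (by fun_prop) measurable_const) (by fun_prop)
    measurable_const

/-- Cauchy–Schwarz with weights `|θ k|`: the clipping error along `θ` then needs only coordinatewise
moments and the `ℓ₁` norm of `θ`. -/
theorem sq_inner_le_l1Norm_mul_sum {d : ℕ} (z θ : EuclideanSpace ℝ (Fin d)) :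
    inner ℝ z θ ^ 2 ≤ l1Norm θ * ∑ k, |θ k| * z k ^ 2 := by
  simp only [PiLp.inner_apply, RCLike.inner_apply, conj_trivial, l1Norm]
  refine Finset.sum_sq_le_sum_mul_sum_of_sq_le_mul _ (fun k _ => abs_nonneg _)
    (fun k _ => by positivity) fun k _ => le_of_eq ?_
  rw [← mul_assoc, abs_mul_abs_self]; ring

theorem abs_clipVec_le {d : ℕ} {τ : ℝ} (hτ : 0 ≤ τ) (z : EuclideanSpace ℝ (Fin d)) (j : Fin d) :
    |clipVec τ z j| ≤ τ := abs_clip_le hτ _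

section

variable {Ω : Type*} [MeasurableSpace Ω] {μ : Measure Ω} [IsProbabilityMeasure μ] {d : ℕ}
  {Z : Ω → EuclideanSpace ℝ (Fin d)} {ξ : Ω → ℝ} {τ r Λ K4 σ : ℝ}

theorem memLp_clipVec (hZm : Measurable Z) (hτ : 0 ≤ τ) (p : ENNReal) :
    MemLp (fun ω => clipVec τ (Z ω)) p μ := by
  refine MemLp.of_bound ((measurable_clipVec τ).comp hZm).aestronglyMeasurable (d * τ)
    (Filter.Eventually.of_forall fun ω => (norm_le_l1Norm _).trans ?_)
  calc l1Norm (clipVec τ (Z ω)) ≤ ∑ _j : Fin d, τ :=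
        Finset.sum_le_sum fun j _ => abs_clipVec_le hτ _ _
    _ = d * τ := by simp

/-- The bias of the score caused by clipping. -/
theorem abs_integral_score_le (hr : 0 < r) (hrτ : r * τ = 1)
    (hZ : MemLp Z 4 μ) (hZm : Measurable Z) (hξm : Measurable ξ)
    (h4 : ∀ k, ∫ ω, Z ω k ^ 4 ∂μ ≤ K4)
    (hscore : ∫ ω, trunc (ξ ω / Λ) • Z ω ∂μ = 0)
    {s : ℕ} {β : EuclideanSpace ℝ (Fin d)} (hβ : l0Norm β ≤ s) (j : Fin d) :
    |∫ ω, trunc (clippedResidual τ Λ β (Z ω, ξ ω)) * clipVec τ (Z ω) j ∂μ|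
      ≤ (2 * s + 1) * K4 * r ^ 3 := by
  have hτ : 0 < τ := pos_of_mul_pos_right (by rw [hrτ]; norm_num) hr.le
  set J := Finset.univ.filter fun j => β j ≠ 0 with hJ
  have hK4 : 0 ≤ K4 := le_trans (integral_nonneg fun ω => by positivity) (h4 j)
  have hZ1 : Integrable Z μ := hZ.integrable (by norm_num)
  have htr : Measurable fun ω => trunc (ξ ω / Λ) := measurable_trunc.comp (hξm.div_const _)
  have hres : Measurable fun ω => clippedResidual τ Λ β (Z ω, ξ ω) :=
    (measurable_clippedResidual τ Λ β).comp (hZm.prodMk hξm)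
  have hclipm : Measurable fun ω => clipVec τ (Z ω) j :=
    (measurable_clip τ).comp (by fun_prop : Measurable fun ω => Z ω j)
  have hI1 : Integrable (fun ω => trunc (ξ ω / Λ) • Z ω) μ :=
    hZ1.bdd_smul 1 htr.aestronglyMeasurable (Filter.Eventually.of_forall fun ω => abs_trunc_le _)
  have hI1j : Integrable (fun ω => trunc (ξ ω / Λ) * Z ω j) μ :=
    (EuclideanSpace.proj (𝕜 := ℝ) j).integrable_comp hI1
  have hz : ∫ ω, trunc (ξ ω / Λ) * Z ω j ∂μ = 0 := by
    have := (EuclideanSpace.proj (𝕜 := ℝ) j).integral_comp_comm hI1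
    rw [hscore, map_zero] at this
    exact this
  have hI2 : Integrable (fun ω => trunc (clippedResidual τ Λ β (Z ω, ξ ω)) * clipVec τ (Z ω) j) μ := by
    refine Integrable.of_bound ((measurable_trunc.comp hres).mul hclipm).aestronglyMeasurable τ
      (Filter.Eventually.of_forall fun ω => ?_)
    rw [norm_mul, Real.norm_eq_abs, Real.norm_eq_abs]
    calc _ ≤ 1 * τ := mul_le_mul (abs_trunc_le _) (abs_clipVec_le hτ.le _ _) (abs_nonneg _) zero_le_one
      _ = τ := one_mul _
  have hI4 : ∀ k, Integrable (fun ω => Z ω k ^ 4) μ := fun k =>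
    integrable_pow_four (memLp_coord hZ k)
  have hsub : ∫ ω, trunc (clippedResidual τ Λ β (Z ω, ξ ω)) * clipVec τ (Z ω) j ∂μ
      = ∫ ω, (trunc (clippedResidual τ Λ β (Z ω, ξ ω)) * clipVec τ (Z ω) j
        - trunc (ξ ω / Λ) * Z ω j) ∂μ := by
    rw [integral_sub hI2 hI1j, hz, sub_zero]
  have hdom : Integrable (fun ω => 2 * r ^ 3 * ∑ k ∈ J, Z ω k ^ 4 + r ^ 3 * Z ω j ^ 4) μ :=
    ((integrable_finsetSum _ fun k _ => hI4 k).const_mul _).add ((hI4 j).const_mul _)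
  rw [hsub]
  calc _ ≤ ∫ ω, (2 * r ^ 3 * ∑ k ∈ J, Z ω k ^ 4 + r ^ 3 * Z ω j ^ 4) ∂μ := by
        refine (abs_integral_le_integral_abs).trans (integral_mono (hI2.sub hI1j).abs hdom
          fun ω => ?_)
        simp only [clipVec_apply]
        have hv := abs_trunc_le (ξ ω / Λ)
        have hu := abs_trunc_le (clippedResidual τ Λ β (Z ω, ξ ω))
        have h1 : |trunc (ξ ω / Λ) * (clip τ (Z ω j) - Z ω j)| ≤ r ^ 3 * Z ω j ^ 4 := by
          rw [abs_mul, abs_sub_comm]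
          calc _ ≤ 1 * |Z ω j - clip τ (Z ω j)| := by gcongr
            _ ≤ _ := by rw [one_mul]; exact abs_sub_clip_le_pow_four hr hrτ _
        have hnn : 0 ≤ 2 * r ^ 3 * ∑ k ∈ J, Z ω k ^ 4 := by positivity
        have h2 : |(trunc (clippedResidual τ Λ β (Z ω, ξ ω)) - trunc (ξ ω / Λ)) * clip τ (Z ω j)|
            ≤ 2 * r ^ 3 * ∑ k ∈ J, Z ω k ^ 4 := by
          -- If no support coordinate is clipped the two scores agree. Otherwise their gap is at
          -- most `2`, and the factor `τ` from the clipped covariate uses up one power of `r⁴`.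
          rcases clippedResidual_eq_or (Λ := Λ) hr hrτ β (Z ω, ξ ω) with h | h
          · rw [h]; simpa using hnn
          · rw [abs_mul]
            simp only at h
            rw [← hJ, ← Finset.mul_sum] at h
            have h3 : |trunc (clippedResidual τ Λ β (Z ω, ξ ω)) - trunc (ξ ω / Λ)| ≤ 2 := by
              rw [abs_le] at hu hv ⊢; constructor <;> linarith
            calc _ ≤ 2 * τ := mul_le_mul h3 (abs_clip_le hτ.le _) (abs_nonneg _) (by norm_num)
              _ ≤ 2 * τ * (r ^ 4 * ∑ k ∈ J, Z ω k ^ 4) := le_mul_of_one_le_right (by positivity) h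
              _ = 2 * (r * τ) * r ^ 3 * ∑ k ∈ J, Z ω k ^ 4 := by ring
              _ = _ := by rw [hrτ]; ring
        have e : trunc (clippedResidual τ Λ β (Z ω, ξ ω)) * clip τ (Z ω j) - trunc (ξ ω / Λ) * Z ω j
            = (trunc (clippedResidual τ Λ β (Z ω, ξ ω)) - trunc (ξ ω / Λ)) * clip τ (Z ω j)
              + trunc (ξ ω / Λ) * (clip τ (Z ω j) - Z ω j) := by ring
        rw [e]
        exact (abs_add_le _ _).trans (add_le_add h2 h1)
    _ = 2 * r ^ 3 * ∑ k ∈ J, ∫ ω, Z ω k ^ 4 ∂μ + r ^ 3 * ∫ ω, Z ω j ^ 4 ∂μ := by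
        rw [integral_add ((integrable_finsetSum _ fun k _ => hI4 k).const_mul _)
          ((hI4 j).const_mul _), integral_const_mul, integral_const_mul,
          integral_finsetSum _ fun k _ => hI4 k]
    _ ≤ 2 * r ^ 3 * (s * K4) + r ^ 3 * K4 := by
        have hcard : (J.card : ℝ) ≤ s := by exact_mod_cast hβ
        have : ∑ k ∈ J, ∫ ω, Z ω k ^ 4 ∂μ ≤ s * K4 := by
          calc _ ≤ ∑ _k ∈ J, K4 := Finset.sum_le_sum fun k _ => h4 k
            _ = J.card * K4 := by simp
            _ ≤ _ := by gcongr
        have := h4 j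
        gcongr
    _ = _ := by ring

/-- Lower bound for the expected truncated square at a net point `v` near `θ`. -/
theorem integral_truncatedSq_ge (hr : 0 < r) (hrτ : r * τ = 1)
    (hZ : MemLp Z 4 μ) (hZm : Measurable Z) (hξm : Measurable ξ)
    (h4 : ∀ k, ∫ ω, Z ω k ^ 4 ∂μ ≤ K4) (hξ : Integrable ξ μ) (hξσ : ∫ ω, |ξ ω| ∂μ ≤ σ)
    {s : ℕ} {β : EuclideanSpace ℝ (Fin d)} (hβ : l0Norm β ≤ s)
    (hK4 : 1 ≤ K4) (hΛ : 18 * K4 * (σ + 1) ≤ Λ) (hsmall : s * K4 ^ 2 * r ^ 4 ≤ 1 / 100)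
    {θ v : EuclideanSpace ℝ (Fin d)} {ρ : ℝ} (hρ : 0 < ρ) (hρ1 : ρ ≤ 1)
    (hθ2 : ∫ ω, inner ℝ (Z ω) θ ^ 2 ∂μ = ρ ^ 2)
    (hθ4 : ∫ ω, inner ℝ (Z ω) θ ^ 4 ∂μ ≤ K4 * (ρ ^ 2) ^ 2) :
    3 / 10 * ρ ^ 2 - 2 * (K4 * r ^ 2 * l1Norm θ ^ 2)
        - 2 * ∫ ω, inner ℝ (clipVec τ (Z ω)) (v - θ) ^ 2 ∂μ
      ≤ ∫ ω, truncatedSq (clippedResidual τ Λ β (Z ω, ξ ω)) Λ (inner ℝ (clipVec τ (Z ω)) v) ∂μ := by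
  have hτ : 0 < τ := pos_of_mul_pos_right (by rw [hrτ]; norm_num) hr.le
  have hσ : 0 ≤ σ := le_trans (integral_nonneg fun ω => abs_nonneg _) hξσ
  have hΛ0 : 0 < Λ := lt_of_lt_of_le (by positivity) hΛ
  have hΛ18 : 18 * K4 ≤ Λ := by nlinarith
  set J := Finset.univ.filter fun j => β j ≠ 0 with hJ
  -- This choice balances the Young terms: the fourth moment of the prediction and the noise part of
  -- `P` each cost at most `ρ²/12`.
  set t := 1 / (3 * K4 * ρ ^ 2) with ht
  have ht0 : 0 < t := by positivity
  have hclip4 := memLp_clipVec (μ := μ) hZm hτ.le 4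
  have hI4 : ∀ k, Integrable (fun ω => Z ω k ^ 4) μ := fun k =>
    integrable_pow_four (memLp_coord hZ k)
  have hA2 := integrable_pow_two (memLp_inner hZ θ)
  have hA4 := integrable_pow_four (memLp_inner hZ θ)
  have hD2 := integrable_pow_two (memLp_inner hclip4 (v - θ))
  have hS : Integrable (fun ω => ∑ k, |θ k| * Z ω k ^ 4) μ :=
    integrable_finsetSum _ fun k _ => (hI4 k).const_mul _
  have hP : Integrable (fun ω => 2 * |ξ ω| / Λ + ∑ k ∈ J, r ^ 4 * Z ω k ^ 4) μ :=
    ((hξ.abs.const_mul 2).div_const Λ).add (integrable_finsetSum _ fun k _ => (hI4 k).const_mul _)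
  have hW : Integrable (fun ω => truncatedSq (clippedResidual τ Λ β (Z ω, ξ ω)) Λ
      (inner ℝ (clipVec τ (Z ω)) v)) μ := by
    refine Integrable.of_bound (measurable_truncatedSq
      ((measurable_clippedResidual τ Λ β).comp (hZm.prodMk hξm)) ?_ Λ).aestronglyMeasurable (Λ ^ 2 / 4)
      (Filter.Eventually.of_forall fun ω => ?_)
    · have := (measurable_clipVec τ).comp hZm
      fun_prop
    · rw [Real.norm_eq_abs, abs_of_nonneg (truncatedSq_nonneg _ _ _)]
      exact truncatedSq_le _ _ _
  have l1 : Integrable (fun ω => 1 / 2 * inner ℝ (Z ω) θ ^ 2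
      - (t / 4 + 2 / Λ ^ 2) * inner ℝ (Z ω) θ ^ 4) μ := (hA2.const_mul _).sub (hA4.const_mul _)
  have l2 : Integrable (fun ω => 1 / 2 * inner ℝ (Z ω) θ ^ 2
      - (t / 4 + 2 / Λ ^ 2) * inner ℝ (Z ω) θ ^ 4
      - (1 / (4 * t)) * (2 * |ξ ω| / Λ + ∑ k ∈ J, r ^ 4 * Z ω k ^ 4)) μ := l1.sub (hP.const_mul _)
  have l3 : Integrable (fun ω => 1 / 2 * inner ℝ (Z ω) θ ^ 2
      - (t / 4 + 2 / Λ ^ 2) * inner ℝ (Z ω) θ ^ 4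
      - (1 / (4 * t)) * (2 * |ξ ω| / Λ + ∑ k ∈ J, r ^ 4 * Z ω k ^ 4)
      - 2 * r ^ 2 * l1Norm θ * (∑ k, |θ k| * Z ω k ^ 4)) μ := l2.sub (hS.const_mul _)
  have l4 : Integrable (fun ω => 1 / 2 * inner ℝ (Z ω) θ ^ 2
      - (t / 4 + 2 / Λ ^ 2) * inner ℝ (Z ω) θ ^ 4
      - (1 / (4 * t)) * (2 * |ξ ω| / Λ + ∑ k ∈ J, r ^ 4 * Z ω k ^ 4)
      - 2 * r ^ 2 * l1Norm θ * (∑ k, |θ k| * Z ω k ^ 4)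
      - 2 * inner ℝ (clipVec τ (Z ω)) (v - θ) ^ 2) μ := l3.sub (hD2.const_mul _)
  have hmono := integral_mono l4 hW fun ω => by
    simp only
    have h1 := truncatedSq_clippedResidual_lower hr hrτ hΛ0 ht0 β (Z ω, ξ ω) (inner ℝ (Z ω) θ)
      (inner ℝ (clipVec τ (Z ω)) v)
    have h2 : (inner ℝ (Z ω) θ - inner ℝ (clipVec τ (Z ω)) v) ^ 2
        ≤ 2 * r ^ 2 * l1Norm θ * (∑ k, |θ k| * Z ω k ^ 4)
          + 2 * inner ℝ (clipVec τ (Z ω)) (v - θ) ^ 2 := by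
      have e : inner ℝ (Z ω) θ - inner ℝ (clipVec τ (Z ω)) v
          = inner ℝ (Z ω - clipVec τ (Z ω)) θ - inner ℝ (clipVec τ (Z ω)) (v - θ) := by
        rw [inner_sub_left, inner_sub_right]; ring
      have h3 := sq_inner_le_l1Norm_mul_sum (Z ω - clipVec τ (Z ω)) θ
      have h4 : ∑ k, |θ k| * (Z ω - clipVec τ (Z ω)) k ^ 2 ≤ r ^ 2 * ∑ k, |θ k| * Z ω k ^ 4 := by
        rw [Finset.mul_sum]
        refine Finset.sum_le_sum fun k _ => ?_
        have h5 := pow_le_pow_left₀ (abs_nonneg _) (abs_sub_clip_le_sq hr hrτ (Z ω k)) 2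
        rw [sq_abs] at h5
        calc |θ k| * (Z ω - clipVec τ (Z ω)) k ^ 2 ≤ |θ k| * (r * Z ω k ^ 2) ^ 2 :=
              mul_le_mul_of_nonneg_left h5 (abs_nonneg _)
          _ = _ := by ring
      have h6 := mul_le_mul_of_nonneg_left h4 (l1Norm_nonneg θ)
      rw [e]
      nlinarith [sq_nonneg (inner ℝ (Z ω - clipVec τ (Z ω)) θ + inner ℝ (clipVec τ (Z ω)) (v - θ))]
    have e2 : 2 * inner ℝ (Z ω) θ ^ 4 / Λ ^ 2 = 2 / Λ ^ 2 * inner ℝ (Z ω) θ ^ 4 := by ring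
    rw [← hJ] at h1
    simp only at h1
    linarith
  rw [integral_sub l3 (hD2.const_mul 2), integral_sub l2 (hS.const_mul _),
    integral_sub l1 (hP.const_mul _), integral_sub (hA2.const_mul _) (hA4.const_mul _),
    integral_const_mul, integral_const_mul, integral_const_mul, integral_const_mul,
    integral_const_mul, hθ2] at hmono
  have hPle : ∫ ω, (2 * |ξ ω| / Λ + ∑ k ∈ J, r ^ 4 * Z ω k ^ 4) ∂μ
      ≤ 1 / (9 * K4) + s * K4 * r ^ 4 := by
    rw [integral_add ((hξ.abs.const_mul 2).div_const Λ)
      (integrable_finsetSum _ fun k _ => (hI4 k).const_mul _), integral_div, integral_const_mul,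
      integral_finsetSum _ fun k _ => (hI4 k).const_mul _]
    refine add_le_add ?_ ?_
    · rw [div_le_div_iff₀ hΛ0 (by positivity)]
      nlinarith
    · have hcard : (J.card : ℝ) ≤ s := by exact_mod_cast hβ
      calc _ ≤ ∑ _k ∈ J, r ^ 4 * K4 := Finset.sum_le_sum fun k _ => by
            rw [integral_const_mul]; have := h4 k; gcongr
        _ = J.card * (r ^ 4 * K4) := by simp
        _ ≤ s * (r ^ 4 * K4) := by gcongr
        _ = _ := by ring
  have hSle : ∫ ω, ∑ k, |θ k| * Z ω k ^ 4 ∂μ ≤ l1Norm θ * K4 := by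
    rw [integral_finsetSum _ fun k _ => (hI4 k).const_mul _, l1Norm, Finset.sum_mul]
    refine Finset.sum_le_sum fun k _ => ?_
    rw [integral_const_mul]; have := h4 k; gcongr
  have hl1 := l1Norm_nonneg θ
  have b1 : (t / 4 + 2 / Λ ^ 2) * ∫ ω, inner ℝ (Z ω) θ ^ 4 ∂μ ≤ (1 / 12 + 1 / 162) * ρ ^ 2 := by
    calc _ ≤ (t / 4 + 2 / (18 * K4) ^ 2) * (K4 * (ρ ^ 2) ^ 2) := by gcongr
      _ = ρ ^ 2 / 12 + 1 / 162 * (ρ ^ 2 * (ρ ^ 2 / K4)) := by rw [ht]; field_simp; ring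
      _ ≤ ρ ^ 2 / 12 + 1 / 162 * (ρ ^ 2 * 1) := by
          have : ρ ^ 2 / K4 ≤ 1 := by
            rw [div_le_one (by positivity)]; exact (pow_le_one₀ hρ.le hρ1).trans hK4
          gcongr
      _ = _ := by ring
  have b2 : 1 / (4 * t) * ∫ ω, (2 * |ξ ω| / Λ + ∑ k ∈ J, r ^ 4 * Z ω k ^ 4) ∂μ
      ≤ (1 / 12 + 3 / 400) * ρ ^ 2 := by
    calc _ ≤ 1 / (4 * t) * (1 / (9 * K4) + s * K4 * r ^ 4) := by gcongr
      _ = ρ ^ 2 / 12 + 3 / 4 * ρ ^ 2 * (s * K4 ^ 2 * r ^ 4) := by rw [ht]; field_simp; ring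
      _ ≤ ρ ^ 2 / 12 + 3 / 4 * ρ ^ 2 * (1 / 100) := by gcongr
      _ = _ := by ring
  have b3 : 2 * r ^ 2 * l1Norm θ * ∫ ω, ∑ k, |θ k| * Z ω k ^ 4 ∂μ
      ≤ 2 * (K4 * r ^ 2 * l1Norm θ ^ 2) := by
    calc _ ≤ 2 * r ^ 2 * l1Norm θ * (l1Norm θ * K4) := by gcongr
      _ = _ := by ring
  have := sq_nonneg ρ
  linarith

end

/-! ### The quadratic form in which the net approximates. -/

/-- The bilinear form `(v, w) ↦ vᵀ G w`. -/
def matrixForm {d : ℕ} (G : Matrix (Fin d) (Fin d) ℝ) :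
    LinearMap.BilinForm ℝ (EuclideanSpace ℝ (Fin d)) :=
  ∑ j, ∑ k, G j k • LinearMap.BilinForm.linMulLin
    (EuclideanSpace.proj (𝕜 := ℝ) j).toLinearMap (EuclideanSpace.proj (𝕜 := ℝ) k).toLinearMap

theorem matrixForm_apply {d : ℕ} (G : Matrix (Fin d) (Fin d) ℝ) (v w : EuclideanSpace ℝ (Fin d)) :
    matrixForm G v w = v.ofLp ⬝ᵥ G.mulVec w.ofLp := by
  simp only [matrixForm, LinearMap.sum_apply, LinearMap.smul_apply,
    LinearMap.BilinForm.linMulLin_apply, smul_eq_mul, dotProduct, Matrix.mulVec, Finset.mul_sum]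
  exact Finset.sum_congr rfl fun j _ => Finset.sum_congr rfl fun k _ => by
    simp; ring

theorem matrixForm_single {d : ℕ} (G : Matrix (Fin d) (Fin d) ℝ) (j : Fin d) :
    matrixForm G (EuclideanSpace.single j 1) (EuclideanSpace.single j 1) = G j j := by
  rw [matrixForm_apply]
  simp

theorem matrixForm_comm {d : ℕ} {G : Matrix (Fin d) (Fin d) ℝ} (hG : ∀ j k, G j k = G k j)
    (v w : EuclideanSpace ℝ (Fin d)) : matrixForm G v w = matrixForm G w v := by
  simp only [matrixForm_apply, dotProduct, Matrix.mulVec, Finset.mul_sum]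
  rw [Finset.sum_comm]
  exact Finset.sum_congr rfl fun j _ => Finset.sum_congr rfl fun k _ => by rw [hG]; ring

/-- The sum of the empirical and the population second moment matrices of the clipped data. -/
def momentMatrix {Ω : Type*} [MeasurableSpace Ω] (μ : Measure Ω) {n d : ℕ}
    (X : Fin n → EuclideanSpace ℝ (Fin d)) (Z : Fin n → Ω → EuclideanSpace ℝ (Fin d)) :
    Matrix (Fin d) (Fin d) ℝ :=
  Matrix.of fun j k => ∑ i, (X i j * X i k + secondMoment μ (Z i) j k)

/-- Adding the two forms lets one application of Maurey's method give a single net point that is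
close to `θ` both on the sample and in mean. -/
theorem matrixForm_momentMatrix {Ω : Type*} [MeasurableSpace Ω] {μ : Measure Ω} {n d : ℕ}
    (X : Fin n → EuclideanSpace ℝ (Fin d)) {Z : Fin n → Ω → EuclideanSpace ℝ (Fin d)}
    (hZ : ∀ i j k, Integrable (fun ω => Z i ω j * Z i ω k) μ) (v : EuclideanSpace ℝ (Fin d)) :
    matrixForm (momentMatrix μ X Z) v v
      = ∑ i, inner ℝ (X i) v ^ 2 + ∑ i, ∫ ω, inner ℝ (Z i ω) v ^ 2 ∂μ := by
  rw [matrixForm_apply, ← Finset.sum_add_distrib]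
  have h : ∀ i, ∫ ω, inner ℝ (Z i ω) v ^ 2 ∂μ
      = ∑ j, ∑ k, v j * (secondMoment μ (Z i) j k * v k) := fun i => by
    rw [← dotProduct_secondMoment (hZ i)]
    simp only [dotProduct, Matrix.mulVec, Finset.mul_sum]
  have h' : ∀ i, inner ℝ (X i) v ^ 2 = ∑ j, ∑ k, v j * (X i j * X i k * v k) := fun i => by
    simp only [PiLp.inner_apply, RCLike.inner_apply, conj_trivial, sq, Finset.sum_mul_sum]
    exact Finset.sum_congr rfl fun j _ => Finset.sum_congr rfl fun k _ => by ring
  simp only [h, h', ← Finset.sum_add_distrib]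
  simp only [dotProduct, Matrix.mulVec, momentMatrix, Matrix.of_apply, Finset.mul_sum,
    Finset.sum_mul]
  rw [Finset.sum_comm' (s := Finset.univ) (t := fun _ => Finset.univ) (t' := Finset.univ)
    (s' := fun _ => Finset.univ) (by simp) (f := fun i j => ∑ k, (v j * (X i j * X i k * v k)
      + v j * (secondMoment μ (Z i) j k * v k)))]
  refine Finset.sum_congr rfl fun j _ => ?_
  rw [Finset.sum_comm]
  exact Finset.sum_congr rfl fun j _ => Finset.sum_congr rfl fun k _ => by ring

/-! ### Tail bounds and the good event. -/

section

variable {Ω : Type*} [MeasurableSpace Ω] {μ : Measure Ω} [IsProbabilityMeasure μ] {n d : ℕ}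
  {x : Fin n → Ω → EuclideanSpace ℝ (Fin d)} {ξ : Fin n → Ω → ℝ} {τ r Λ : ℝ}

theorem sq_clip_le_sq (hτ : 0 ≤ τ) (a : ℝ) : clip τ a ^ 2 ≤ a ^ 2 :=
  sq_le_sq.2 (abs_clip_le_abs hτ a)

theorem integral_sq_clipVec_le (hτ : 0 ≤ τ) {Z : Ω → EuclideanSpace ℝ (Fin d)}
    (hZ : MemLp Z 4 μ) (hZm : Measurable Z) {j : Fin d} (h2 : ∫ ω, Z ω j ^ 2 ∂μ ≤ 1) :
    ∫ ω, clipVec τ (Z ω) j ^ 2 ∂μ ≤ 1 :=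
  (integral_mono (integrable_pow_two (memLp_coord (memLp_clipVec hZm hτ 4) j))
    (integrable_pow_two (memLp_coord hZ j)) fun _ => sq_clip_le_sq hτ _).trans h2

/-- Scaling by `r = 1/τ` makes the summands bounded by one, with mean and second moment at most `r²`
each. The exponent is thus `2nr² - 4nr²`. The sign `ε` covers both tails. -/
theorem measureReal_gradient_ge_le (hr : 0 < r) (hrτ : r * τ = 1)
    (hind : iIndepFun (fun i ω => (x i ω, ξ i ω)) μ) (hx : ∀ i, MemLp (x i) 4 μ)
    (hxm : ∀ i, Measurable (x i)) (hξm : ∀ i, Measurable (ξ i))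
    {β : EuclideanSpace ℝ (Fin d)} {j : Fin d} (hx2 : ∀ i, ∫ ω, x i ω j ^ 2 ∂μ ≤ 1)
    (hbias : ∀ i, |∫ ω, trunc (clippedResidual τ Λ β (x i ω, ξ i ω)) * clipVec τ (x i ω) j ∂μ| ≤ r)
    {ε : ℝ} (hε : |ε| = 1) :
    μ.real {ω | 4 * (n * r ^ 2)
        ≤ ∑ i, ε * r * (trunc (clippedResidual τ Λ β (x i ω, ξ i ω)) * clipVec τ (x i ω) j)}
      ≤ Real.exp (-2 * (n * r ^ 2)) := by
  have hτ : 0 < τ := pos_of_mul_pos_right (by rw [hrτ]; norm_num) hr.le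
  have hε2 : ε ^ 2 = 1 := by rw [← sq_abs, hε, one_pow]
  let φ : EuclideanSpace ℝ (Fin d) × ℝ → ℝ := fun z =>
    ε * r * (trunc (clippedResidual τ Λ β z) * clipVec τ z.1 j)
  have hclip : Measurable fun z : EuclideanSpace ℝ (Fin d) × ℝ => clipVec τ z.1 j :=
    (measurable_clip τ).comp (by fun_prop : Measurable fun z : EuclideanSpace ℝ (Fin d) × ℝ => z.1 j)
  have hφ : Measurable φ :=
    ((measurable_trunc.comp (measurable_clippedResidual τ Λ β)).mul hclip).const_mul _
  have hsq : ∀ z, φ z ^ 2 ≤ r ^ 2 * clipVec τ z.1 j ^ 2 := fun z => by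
    have h1 : trunc (clippedResidual τ Λ β z) ^ 2 ≤ 1 := (sq_le_one_iff_abs_le_one _).2 (abs_trunc_le _)
    calc φ z ^ 2 = ε ^ 2 * (r ^ 2 * (trunc (clippedResidual τ Λ β z) ^ 2 * clipVec τ z.1 j ^ 2)) := by
          simp only [φ]; ring
      _ ≤ 1 * (r ^ 2 * (1 * clipVec τ z.1 j ^ 2)) := by rw [hε2]; gcongr
      _ = _ := by ring
  have hb : ∀ z, |φ z| ≤ 1 := fun z => by
    rw [← sq_le_one_iff_abs_le_one]
    refine (hsq z).trans ?_
    rw [← mul_pow, sq_le_one_iff_abs_le_one, abs_mul, abs_of_pos hr, ← hrτ]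
    exact mul_le_mul_of_nonneg_left (abs_clipVec_le hτ.le _ _) hr.le
  have hc : ∀ i, ∫ ω, φ (x i ω, ξ i ω) ∂μ + ∫ ω, φ (x i ω, ξ i ω) ^ 2 ∂μ ≤ 2 * r ^ 2 := fun i => by
    have h1 : ∫ ω, φ (x i ω, ξ i ω) ∂μ ≤ r ^ 2 := by
      simp only [φ]
      rw [integral_const_mul]
      refine (le_abs_self _).trans ?_
      rw [abs_mul, abs_mul, hε, abs_of_pos hr, one_mul, sq]
      exact mul_le_mul_of_nonneg_left (hbias i) hr.le
    have h2 : ∫ ω, φ (x i ω, ξ i ω) ^ 2 ∂μ ≤ r ^ 2 := by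
      calc _ ≤ ∫ ω, r ^ 2 * clipVec τ (x i ω) j ^ 2 ∂μ :=
            integral_mono_of_nonneg (Filter.Eventually.of_forall fun ω => sq_nonneg _)
              ((integrable_pow_two (memLp_coord (memLp_clipVec (hxm i) hτ.le 4) j)).const_mul _)
              (Filter.Eventually.of_forall fun ω => hsq (x i ω, ξ i ω))
        _ = r ^ 2 * ∫ ω, clipVec τ (x i ω) j ^ 2 ∂μ := integral_const_mul _ _
        _ ≤ r ^ 2 * 1 := by
            gcongr; exact integral_sq_clipVec_le hτ.le (hx i) (hxm i) (hx2 i)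
        _ = _ := mul_one _
    linarith
  have := measureReal_sum_ge_le hind (fun i => (hxm i).prodMk (hξm i)) hφ hb hc (4 * (n * r ^ 2))
  refine this.trans (le_of_eq ?_)
  congr 1
  simp; ring

theorem measureReal_secondMoment_ge_le (hr : 0 < r) (hrτ : r * τ = 1)
    (hind : iIndepFun (fun i ω => (x i ω, ξ i ω)) μ) (hx : ∀ i, MemLp (x i) 4 μ)
    (hxm : ∀ i, Measurable (x i)) (hξm : ∀ i, Measurable (ξ i))
    {j : Fin d} (hx2 : ∀ i, ∫ ω, x i ω j ^ 2 ∂μ ≤ 1) :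
    μ.real {ω | 4 * (n * r ^ 2) ≤ ∑ i, r ^ 2 * clipVec τ (x i ω) j ^ 2}
      ≤ Real.exp (-2 * (n * r ^ 2)) := by
  have hτ : 0 < τ := pos_of_mul_pos_right (by rw [hrτ]; norm_num) hr.le
  let φ : EuclideanSpace ℝ (Fin d) × ℝ → ℝ := fun z => r ^ 2 * clipVec τ z.1 j ^ 2
  have hclip : Measurable fun z : EuclideanSpace ℝ (Fin d) × ℝ => clipVec τ z.1 j :=
    (measurable_clip τ).comp (by fun_prop : Measurable fun z : EuclideanSpace ℝ (Fin d) × ℝ => z.1 j)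
  have hφ : Measurable φ := (hclip.pow_const 2).const_mul _
  have h0 : ∀ z, 0 ≤ φ z := fun z => by positivity
  have h1 : ∀ z, φ z ≤ 1 := fun z => by
    simp only [φ]
    rw [← mul_pow, sq_le_one_iff_abs_le_one, abs_mul, abs_of_pos hr, ← hrτ]
    exact mul_le_mul_of_nonneg_left (abs_clipVec_le hτ.le _ _) hr.le
  have hc : ∀ i, ∫ ω, φ (x i ω, ξ i ω) ∂μ + ∫ ω, φ (x i ω, ξ i ω) ^ 2 ∂μ ≤ 2 * r ^ 2 := fun i => by
    have hint : Integrable (fun ω => φ (x i ω, ξ i ω)) μ :=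
      (integrable_pow_two (memLp_coord (memLp_clipVec (hxm i) hτ.le 4) j)).const_mul _
    have h2 : ∫ ω, φ (x i ω, ξ i ω) ∂μ ≤ r ^ 2 := by
      simp only [φ]
      rw [integral_const_mul]
      have := integral_sq_clipVec_le hτ.le (hx i) (hxm i) (hx2 i)
      nlinarith [sq_nonneg r]
    have h3 : ∫ ω, φ (x i ω, ξ i ω) ^ 2 ∂μ ≤ ∫ ω, φ (x i ω, ξ i ω) ∂μ :=
      integral_mono_of_nonneg (Filter.Eventually.of_forall fun ω => sq_nonneg _) hint
        (Filter.Eventually.of_forall fun ω => pow_le_of_le_one (h0 _) (h1 _) two_ne_zero)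
    linarith
  have := measureReal_sum_ge_le hind (fun i => (hxm i).prodMk (hξm i)) hφ
    (fun z => by rw [abs_of_nonneg (h0 z)]; exact h1 z) hc (4 * (n * r ^ 2))
  refine this.trans (le_of_eq ?_)
  congr 1
  simp; ring

/-- Multiplicative lower tail bound for the truncated squares. -/
theorem measureReal_truncatedSq_le_le (hΛ : 0 < Λ)
    (hind : iIndepFun (fun i ω => (x i ω, ξ i ω)) μ)
    (hxm : ∀ i, Measurable (x i)) (hξm : ∀ i, Measurable (ξ i))
    (β v : EuclideanSpace ℝ (Fin d)) (L : ℝ) :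
    μ.real {ω | ∑ i, truncatedSq (clippedResidual τ Λ β (x i ω, ξ i ω)) Λ (inner ℝ (clipVec τ (x i ω)) v)
        ≤ (∑ i, ∫ ω', truncatedSq (clippedResidual τ Λ β (x i ω', ξ i ω')) Λ
            (inner ℝ (clipVec τ (x i ω')) v) ∂μ) / 2 - Λ ^ 2 / 2 * L}
      ≤ Real.exp (-L) := by
  let W : EuclideanSpace ℝ (Fin d) × ℝ → ℝ := fun z =>
    truncatedSq (clippedResidual τ Λ β z) Λ (inner ℝ (clipVec τ z.1) v)
  -- The cap `Λ²/4` puts `φ` in `[-1/2, 0]`, so `φ² ≤ -φ/2` and the second moment eats only half of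
  -- the mean. The bound is therefore relative to the mean.
  let φ : EuclideanSpace ℝ (Fin d) × ℝ → ℝ := fun z => -(2 / Λ ^ 2) * W z
  have hWm : Measurable W := by
    refine measurable_truncatedSq (measurable_clippedResidual τ Λ β) ?_ Λ
    have := (measurable_clipVec (d := d) τ)
    fun_prop
  have hφ : Measurable φ := hWm.const_mul _
  have hW0 : ∀ z, 0 ≤ W z := fun z => truncatedSq_nonneg _ _ _
  have hφ0 : ∀ z, φ z ≤ 0 := fun z => by
    simp only [φ]; have := hW0 z
    have : 0 ≤ 2 / Λ ^ 2 * W z := by positivity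
    linarith
  have hφ1 : ∀ z, -(1 / 2) ≤ φ z := fun z => by
    have h : W z ≤ Λ ^ 2 / 4 := truncatedSq_le _ _ _
    have : 2 / Λ ^ 2 * W z ≤ 2 / Λ ^ 2 * (Λ ^ 2 / 4) := by gcongr
    have e : 2 / Λ ^ 2 * (Λ ^ 2 / 4) = 1 / 2 := by field_simp; norm_num
    simp only [φ]; linarith
  have hb : ∀ z, |φ z| ≤ 1 := fun z => by
    have h0 := hφ0 z
    have h1 := hφ1 z
    rw [abs_le]; constructor <;> linarith
  have hint : ∀ i, Integrable (fun ω => φ (x i ω, ξ i ω)) μ := fun i =>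
    Integrable.of_bound (hφ.comp ((hxm i).prodMk (hξm i))).aestronglyMeasurable 1
      (Filter.Eventually.of_forall fun ω => hb _)
  have hc : ∀ i, ∫ ω, φ (x i ω, ξ i ω) ∂μ + ∫ ω, φ (x i ω, ξ i ω) ^ 2 ∂μ
      ≤ -(1 / Λ ^ 2) * ∫ ω, W (x i ω, ξ i ω) ∂μ := fun i => by
    have h1 : ∫ ω, φ (x i ω, ξ i ω) ^ 2 ∂μ ≤ ∫ ω, -(1 / 2) * φ (x i ω, ξ i ω) ∂μ :=
      integral_mono_of_nonneg (Filter.Eventually.of_forall fun ω => sq_nonneg _)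
        ((hint i).const_mul _) (Filter.Eventually.of_forall fun ω => by
          have h0 := hφ0 (x i ω, ξ i ω)
          have h1 := hφ1 (x i ω, ξ i ω)
          simp only
          nlinarith)
    rw [integral_const_mul] at h1
    have h2 : ∫ ω, φ (x i ω, ξ i ω) ∂μ = -(2 / Λ ^ 2) * ∫ ω, W (x i ω, ξ i ω) ∂μ :=
      integral_const_mul _ _
    have e : -(1 / Λ ^ 2) * ∫ ω, W (x i ω, ξ i ω) ∂μ
      = (-(2 / Λ ^ 2) * ∫ ω, W (x i ω, ξ i ω) ∂μ) / 2 := by ring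
    rw [e, ← h2]; linarith
  have := measureReal_sum_ge_le hind (fun i => (hxm i).prodMk (hξm i)) hφ hb hc
    (L - 1 / Λ ^ 2 * ∑ i, ∫ ω, W (x i ω, ξ i ω) ∂μ)
  rw [← Finset.mul_sum] at this
  refine (le_of_eq ?_).trans (this.trans (le_of_eq ?_))
  · congr 1
    ext ω
    simp only [Set.mem_ofPred_eq, φ, ← Finset.mul_sum]
    change ∑ i, W (x i ω, ξ i ω) ≤ (∑ i, ∫ ω', W (x i ω', ξ i ω') ∂μ) / 2 - Λ ^ 2 / 2 * L ↔ _
    set a := ∑ i, W (x i ω, ξ i ω)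
    set b := ∑ i, ∫ ω', W (x i ω', ξ i ω') ∂μ
    have e : -(2 / Λ ^ 2) * a - (L - 1 / Λ ^ 2 * b) = 2 / Λ ^ 2 * (b / 2 - Λ ^ 2 / 2 * L - a) := by
      field_simp; ring
    rw [← sub_nonneg, ← sub_nonneg (b := L - 1 / Λ ^ 2 * b), e]
    exact (mul_nonneg_iff_of_pos_left (by positivity)).symm
  · congr 1; ring

/-- The event on which the gradient is small, the clipped covariates have bounded empirical second
moments, and the truncated squares are bounded below on the net. -/
theorem exists_good_event {δ : ℝ} (hδ0 : 0 < δ) (hδ1 : δ < 1) (hd : 3 ≤ d)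
    (hr : 0 < r) (hrτ : r * τ = 1) (hrn : n * r ^ 2 = Real.log (d / δ)) (hΛ : 0 < Λ)
    (hind : iIndepFun (fun i ω => (x i ω, ξ i ω)) μ) (hx : ∀ i, MemLp (x i) 4 μ)
    (hxm : ∀ i, Measurable (x i)) (hξm : ∀ i, Measurable (ξ i))
    {β : EuclideanSpace ℝ (Fin d)} (hx2 : ∀ i j, ∫ ω, x i ω j ^ 2 ∂μ ≤ 1)
    (hbias : ∀ i j, |∫ ω, trunc (clippedResidual τ Λ β (x i ω, ξ i ω)) * clipVec τ (x i ω) j ∂μ| ≤ r)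
    (m : ℕ) (R : ℝ) :
    ∃ A : Set Ω, MeasurableSet A ∧ 1 - 2 * δ ≤ μ.real A ∧ ∀ ω ∈ A,
      (∀ j, |∑ i, trunc (clippedResidual τ Λ β (x i ω, ξ i ω)) * clipVec τ (x i ω) j| ≤ n * (4 * r)) ∧
      (∀ j, ∑ i, clipVec τ (x i ω) j ^ 2 ≤ 4 * n) ∧
      ∀ g : Fin m → Fin d × Bool,
        (∑ i, ∫ ω', truncatedSq (clippedResidual τ Λ β (x i ω', ξ i ω')) Λ
            (inner ℝ (clipVec τ (x i ω')) (crossAverage R g)) ∂μ) / 2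
          - Λ ^ 2 * ((m + 1) * (n * r ^ 2))
        ≤ ∑ i, truncatedSq (clippedResidual τ Λ β (x i ω, ξ i ω)) Λ
            (inner ℝ (clipVec τ (x i ω)) (crossAverage R g)) := by
  have hd' : (3 : ℝ) ≤ d := by exact_mod_cast hd
  have hclip : ∀ i, Measurable fun ω => clipVec τ (x i ω) := fun i =>
    (measurable_clipVec τ).comp (hxm i)
  have hclipj : ∀ i j, Measurable fun ω => clipVec τ (x i ω) j := fun i j =>
    (measurable_clip τ).comp (by have := hxm i; fun_prop : Measurable fun ω => x i ω j)
  have hres : ∀ i, Measurable fun ω => clippedResidual τ Λ β (x i ω, ξ i ω) := fun i =>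
    (measurable_clippedResidual τ Λ β).comp ((hxm i).prodMk (hξm i))
  let sgn : Bool → ℝ := fun b => if b then 1 else -1
  have hsgn : ∀ b, |sgn b| = 1 := fun b => by cases b <;> simp [sgn]
  let B1 : Fin d × Bool → Set Ω := fun q => {ω | 4 * (n * r ^ 2)
    ≤ ∑ i, sgn q.2 * r * (trunc (clippedResidual τ Λ β (x i ω, ξ i ω)) * clipVec τ (x i ω) q.1)}
  let B2 : Fin d → Set Ω := fun j => {ω | 4 * (n * r ^ 2) ≤ ∑ i, r ^ 2 * clipVec τ (x i ω) j ^ 2}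
  let B3 : (Fin m → Fin d × Bool) → Set Ω := fun g =>
    {ω | ∑ i, truncatedSq (clippedResidual τ Λ β (x i ω, ξ i ω)) Λ
        (inner ℝ (clipVec τ (x i ω)) (crossAverage R g))
      ≤ (∑ i, ∫ ω', truncatedSq (clippedResidual τ Λ β (x i ω', ξ i ω')) Λ
          (inner ℝ (clipVec τ (x i ω')) (crossAverage R g)) ∂μ) / 2
        - Λ ^ 2 / 2 * (2 * (m + 1) * (n * r ^ 2))}
  have m1 : ∀ q, MeasurableSet (B1 q) := fun q => measurableSet_le measurable_const
    (Finset.measurable_sum _ fun i _ =>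
      ((measurable_trunc.comp (hres i)).mul (hclipj i q.1)).const_mul _)
  have m2 : ∀ j, MeasurableSet (B2 j) := fun j => measurableSet_le measurable_const
    (Finset.measurable_sum _ fun i _ => ((hclipj i j).pow_const 2).const_mul _)
  have m3 : ∀ g, MeasurableSet (B3 g) := fun g => measurableSet_le
    (Finset.measurable_sum _ fun i _ => measurable_truncatedSq (hres i)
      (by have := hclip i; fun_prop) Λ) measurable_const
  have hmB : MeasurableSet ((⋃ q, B1 q) ∪ (⋃ j, B2 j) ∪ ⋃ g, B3 g) :=
    ((MeasurableSet.iUnion m1).union (MeasurableSet.iUnion m2)).union (MeasurableSet.iUnion m3)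
  set q := Real.exp (-Real.log (d / δ)) with hq
  have hqv : q = δ / d := by
    rw [hq, Real.exp_neg, Real.exp_log (by positivity), inv_div]
  have hq2 : Real.exp (-2 * (n * r ^ 2)) = q ^ 2 := by
    rw [hrn, hq, ← Real.exp_nat_mul]; congr 1; push_cast; ring
  have p1 : ∀ a, μ.real (B1 a) ≤ q ^ 2 := fun a => by
    rw [← hq2]
    exact measureReal_gradient_ge_le hr hrτ hind hx hxm hξm (fun i => hx2 i a.1)
      (fun i => hbias i a.1) (hsgn a.2)
  have p2 : ∀ j, μ.real (B2 j) ≤ q ^ 2 := fun j => by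
    rw [← hq2]
    exact measureReal_secondMoment_ge_le hr hrτ hind hx hxm hξm (fun i => hx2 i j)
  -- The exponent `m + 1` pays for the `(2d)^m` net points and leaves one factor `q²`. With `q =
  -- δ/d` the three unions cost at most `2δ/3`, `δ/3` and `δ`.
  have p3 : ∀ g, μ.real (B3 g) ≤ (q ^ 2) ^ (m + 1) := fun g => by
    refine (measureReal_truncatedSq_le_le hΛ hind hxm hξm β (crossAverage R g) _).trans
      (le_of_eq ?_)
    rw [hrn, hq, ← pow_mul, ← Real.exp_nat_mul]; congr 1; push_cast; ring
  have hbad : μ.real ((⋃ q, B1 q) ∪ (⋃ j, B2 j) ∪ ⋃ g, B3 g) ≤ 2 * δ := by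
    have u1 : μ.real (⋃ q, B1 q) ≤ 2 * d * q ^ 2 := by
      refine (measureReal_iUnion_fintype_le _).trans
        ((Finset.sum_le_sum fun a _ => p1 a).trans (le_of_eq ?_))
      simp only [Finset.sum_const, Finset.card_univ, Fintype.card_prod, Fintype.card_fin,
        Fintype.card_bool, nsmul_eq_mul]
      push_cast; ring
    have u2 : μ.real (⋃ j, B2 j) ≤ d * q ^ 2 := by
      refine (measureReal_iUnion_fintype_le _).trans
        ((Finset.sum_le_sum fun a _ => p2 a).trans (le_of_eq ?_))
      simp
    have u3 : μ.real (⋃ g, B3 g) ≤ (2 * d * q ^ 2) ^ m * q ^ 2 := by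
      refine (measureReal_iUnion_fintype_le _).trans
        ((Finset.sum_le_sum fun a _ => p3 a).trans (le_of_eq ?_))
      simp; ring
    have hdq : d * q ^ 2 ≤ δ / 3 := by
      have : d * q ^ 2 = δ * (δ / d) := by rw [hqv]; field_simp
      rw [this]
      have : δ / d ≤ 1 / 3 := by
        rw [div_le_div_iff₀ (by linarith) (by norm_num)]; linarith
      nlinarith
    have hqδ : q ^ 2 ≤ δ := by nlinarith [sq_nonneg q]
    have hpow : (2 * d * q ^ 2) ^ m ≤ 1 := pow_le_one₀ (by positivity) (by linarith)
    have h3 : (2 * d * q ^ 2) ^ m * q ^ 2 ≤ 1 * δ := by gcongr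
    have := measureReal_union_le (μ := μ) ((⋃ q, B1 q) ∪ (⋃ j, B2 j)) (⋃ g, B3 g)
    have := measureReal_union_le (μ := μ) (⋃ q, B1 q) (⋃ j, B2 j)
    linarith
  refine ⟨((⋃ q, B1 q) ∪ (⋃ j, B2 j) ∪ ⋃ g, B3 g)ᶜ, hmB.compl, ?_, fun ω hω => ?_⟩
  · rw [probReal_compl_eq_one_sub hmB]; linarith
  · simp only [Set.mem_compl_iff, Set.mem_union, Set.mem_iUnion, not_or, not_exists, B1, B2, B3,
      Set.mem_ofPred_eq, not_le, ← Finset.mul_sum] at hω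
    obtain ⟨⟨h1, h2⟩, h3⟩ := hω
    refine ⟨fun j => ?_, fun j => ?_, fun g => ?_⟩
    · have ht := h1 (j, true)
      have hf := h1 (j, false)
      simp only [sgn, if_true, Bool.false_eq_true, if_false] at ht hf
      set a := ∑ i, trunc (clippedResidual τ Λ β (x i ω, ξ i ω)) * clipVec τ (x i ω) j
      rw [abs_le]
      constructor
      · have : r * -a ≤ r * (n * (4 * r)) := by linarith
        linarith [le_of_mul_le_mul_left this hr]
      · have : r * a ≤ r * (n * (4 * r)) := by linarith
        exact le_of_mul_le_mul_left this hr
    · have : r ^ 2 * ∑ i, clipVec τ (x i ω) j ^ 2 ≤ r ^ 2 * (4 * n) := by linarith [h2 j]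
      exact le_of_mul_le_mul_left this (by positivity)
    · refine le_trans (le_of_eq ?_) (h3 g).le
      ring

end

/-! ### Uniform curvature on the localized sphere. -/

/-- Restricted strong convexity on a sphere, from the bounds on the net. -/
theorem sum_truncatedSq_gt {Ω : Type*} [MeasurableSpace Ω] {μ : Measure Ω} [IsProbabilityMeasure μ]
    {n d s m : ℕ} (hn : 0 < n) (hd : 0 < d) (hm : 0 < m)
    {x : Fin n → Ω → EuclideanSpace ℝ (Fin d)} {ξ : Fin n → Ω → ℝ} {τ r Λ K4 σ : ℝ}
    (hr : 0 < r) (hrτ : r * τ = 1)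
    (hx : ∀ i, MemLp (x i) 4 μ) (hxm : ∀ i, Measurable (x i)) (hξm : ∀ i, Measurable (ξ i))
    (hx2 : ∀ i j, ∫ ω, x i ω j ^ 2 ∂μ ≤ 1)
    (h4 : ∀ i j, ∫ ω, x i ω j ^ 4 ∂μ ≤ K4) (hξ : ∀ i, Integrable (ξ i) μ)
    (hξσ : ∀ i, ∫ ω, |ξ i ω| ∂μ ≤ σ)
    {β : EuclideanSpace ℝ (Fin d)} (hβ : l0Norm β ≤ s)
    (hK4 : 1 ≤ K4) (hΛ : 18 * K4 * (σ + 1) ≤ Λ) (hsmall : s * K4 ^ 2 * r ^ 4 ≤ 1 / 100)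
    {ρ R : ℝ} (hρ : 0 < ρ) (hρ1 : ρ ≤ 1) (hR : 0 < R)
    (hmR : 500 * R ^ 2 ≤ m * ρ ^ 2) (hRr : K4 * r ^ 2 * R ^ 2 ≤ ρ ^ 2 / 100)
    (hΛm : Λ ^ 2 * ((m + 1) * r ^ 2) ≤ ρ ^ 2 / 100)
    {u : Fin n → ℝ} {X : Fin n → EuclideanSpace ℝ (Fin d)}
    (hX2 : ∀ j, ∑ i, X i j ^ 2 ≤ 4 * n)
    (hnet : ∀ g : Fin m → Fin d × Bool,
        (∑ i, ∫ ω', truncatedSq (clippedResidual τ Λ β (x i ω', ξ i ω')) Λ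
            (inner ℝ (clipVec τ (x i ω')) (crossAverage R g)) ∂μ) / 2
          - Λ ^ 2 * ((m + 1) * (n * r ^ 2))
        ≤ ∑ i, truncatedSq (u i) Λ (inner ℝ (X i) (crossAverage R g)))
    {θ : EuclideanSpace ℝ (Fin d)} (hθR : l1Norm θ ≤ R)
    (hθ2 : ∀ i, ∫ ω, inner ℝ (x i ω) θ ^ 2 ∂μ = ρ ^ 2)
    (hθ4 : ∀ i, ∫ ω, inner ℝ (x i ω) θ ^ 4 ∂μ ≤ K4 * (ρ ^ 2) ^ 2) :
    n * (ρ ^ 2 / 36) < ∑ i, truncatedSq (u i) Λ (inner ℝ (X i) θ) := by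
  have hτ : 0 < τ := pos_of_mul_pos_right (by rw [hrτ]; norm_num) hr.le
  have hn' : (0 : ℝ) < n := by exact_mod_cast hn
  have hm' : (0 : ℝ) < m := by exact_mod_cast hm
  have hclip : ∀ i, MemLp (fun ω => clipVec τ (x i ω)) 4 μ := fun i => memLp_clipVec (hxm i) hτ.le 4
  have hform := matrixForm_momentMatrix (μ := μ) X (Z := fun i ω => clipVec τ (x i ω))
    fun i => integrable_coord_mul (hclip i)
  have hdiag : ∀ j, matrixForm (momentMatrix μ X fun i ω => clipVec τ (x i ω))
      (EuclideanSpace.single j 1) (EuclideanSpace.single j 1) ≤ 5 * n := fun j => by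
    rw [matrixForm_single]
    simp only [momentMatrix, Matrix.of_apply, secondMoment, ← sq, Finset.sum_add_distrib]
    have h1 : ∑ i, ∫ ω, clipVec τ (x i ω) j ^ 2 ∂μ ≤ n := by
      calc _ ≤ ∑ _i : Fin n, (1 : ℝ) := Finset.sum_le_sum fun i _ =>
            integral_sq_clipVec_le hτ.le (hx i) (hxm i) (hx2 i j)
        _ = n := by simp
    linarith [hX2 j]
  obtain ⟨g, hg⟩ := exists_crossAverage_sub_le hd hm hR hθR
    (matrixForm (momentMatrix μ X fun i ω => clipVec τ (x i ω)))
    (matrixForm_comm fun j k => by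
      simp only [momentMatrix, Matrix.of_apply, secondMoment]
      exact Finset.sum_congr rfl fun i _ => by simp only [mul_comm])
    (fun v => by
      rw [hform]
      exact add_nonneg (Finset.sum_nonneg fun i _ => sq_nonneg _)
        (Finset.sum_nonneg fun i _ => integral_nonneg fun ω => sq_nonneg _))
    hdiag
  set v := crossAverage R g
  rw [hform] at hg
  -- The `5n` is `4n` from the sample and `n` from the population.
  have hg' : R ^ 2 * (5 * n) / m ≤ n * (ρ ^ 2 / 100) := by
    rw [div_le_iff₀ hm']
    nlinarith
  have hpop := Finset.sum_le_sum fun i (_ : i ∈ Finset.univ) =>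
    integral_truncatedSq_ge (v := v) hr hrτ (hx i) (hxm i) (hξm i) (h4 i) (hξ i) (hξσ i) hβ hK4 hΛ
      hsmall hρ hρ1 (hθ2 i) (hθ4 i)
  rw [Finset.sum_sub_distrib, ← Finset.mul_sum, Finset.sum_const, Finset.card_univ,
    Fintype.card_fin, nsmul_eq_mul] at hpop
  have hl : K4 * r ^ 2 * l1Norm θ ^ 2 ≤ ρ ^ 2 / 100 := by
    have := pow_le_pow_left₀ (l1Norm_nonneg θ) hθR 2
    refine le_trans ?_ hRr
    gcongr
  have hloc := Finset.sum_le_sum fun i (_ : i ∈ Finset.univ) =>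
    truncatedSq_half_le (u i) Λ (inner ℝ (X i) v) (inner ℝ (X i) θ)
  rw [Finset.sum_sub_distrib, ← Finset.sum_div] at hloc
  simp only [← inner_sub_right] at hloc
  have hnetg := hnet g
  rw [show crossAverage R g = v from rfl] at hnetg
  have hP : 0 ≤ ∑ i, ∫ ω, inner ℝ (clipVec τ (x i ω)) (v - θ) ^ 2 ∂μ :=
    Finset.sum_nonneg fun i _ => integral_nonneg fun ω => sq_nonneg _
  have hnl : n * (3 / 10 * ρ ^ 2 - 2 * (ρ ^ 2 / 100))
      ≤ n * (3 / 10 * ρ ^ 2 - 2 * (K4 * r ^ 2 * l1Norm θ ^ 2)) := by gcongr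
  have hnΛ : n * (Λ ^ 2 * ((m + 1) * r ^ 2)) ≤ n * (ρ ^ 2 / 100) := by gcongr
  have hnρ : 0 < n * ρ ^ 2 := by positivity
  -- Per observation and in units of `ρ²`: the mean at the net point is at least `0.28` before
  -- approximation error, so the net bound gives `0.14 - 0.01`. Moving to `θ` halves this, and the
  -- approximation errors cost at most `0.01` in total. The remaining `0.055` exceeds `1/36`.
  have hfin : Λ ^ 2 * ((m + 1) * (n * r ^ 2)) = n * (Λ ^ 2 * ((m + 1) * r ^ 2)) := by ring
  linarith

end SparseHuber
end

open SparseHuber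

/-! ### Choice of constants and assembly. -/

theorem theorem1
    {Ω : Type*} [MeasurableSpace Ω] (μ : Measure Ω) [IsProbabilityMeasure μ]
    (n d s : ℕ) (hn : 0 < n) (hd : 3 ≤ d) (hs : 1 ≤ s) (hsd : s < d)
    -- the linear model `y = xᵀ β* + ξ`
    (x : Fin n → Ω → EuclideanSpace ℝ (Fin d)) (ξ y : Fin n → Ω → ℝ)
    (βstar : EuclideanSpace ℝ (Fin d))
    (hy : ∀ i ω, y i ω = inner ℝ (x i ω) βstar + ξ i ω)
    (hβ : l0Norm βstar ≤ s)
    -- the sampling: the pairs are independent, the covariates are identically distributed, and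
    -- so are the noises
    (hxm : ∀ i, Measurable (x i)) (hξm : ∀ i, Measurable (ξ i))
    (hindep : iIndepFun (fun i ω => (x i ω, ξ i ω)) μ)
    (hxid : ∀ i j, IdentDistrib (x i) (x j) μ μ)
    (hξid : ∀ i j, IdentDistrib (ξ i) (ξ j) μ μ)
    -- the covariates
    (K cRE κ κl : ℝ) (S : Matrix (Fin d) (Fin d) ℝ)
    (hx0 : ∀ i, ∫ ω, x i ω ∂μ = 0)
    (hxK : ∀ i, FiniteKurtosis μ (x i) K)
    (hx2 : ∀ i j, ∫ ω, (x i ω j) ^ 2 ∂μ ≤ 1)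
    (hS : ∀ i, secondMoment μ (x i) = S)
    (hRE : RestrictedEigenvalue S s cRE κ)
    (hκl : SparseEigenvalue S s κl)
    -- the noise
    (σ lamO : ℝ)
    (hξ1 : ∀ i, Integrable (ξ i) μ)
    (hξσ : ∀ i, ∫ ω, |ξ i ω| ∂μ ≤ σ)
    (hscore : ∀ i, ∫ ω, huberScore (ξ i ω / (lamO * √(n : ℝ))) • x i ω ∂μ = 0)
    -- the tuning parameters
    (δ τ lamS cs cr cr₁ cr₂ rS r₁ r₂ : ℝ)
    (hδ0 : 0 < δ) (hδ1 : δ < 1) (hcRE : 1 < cRE)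
    (hτ : τ = √((n : ℝ) / Real.log (d / δ)))
    (hlamO : 18 * K ^ 4 * (σ + 1) ≤ lamO * √(n : ℝ))
    (hcs : 16 ≤ cs)
    (hlamS : lamS = cs * ((cRE + 1) / (cRE - 1)) * (lamO * √(n : ℝ))
      * √(Real.log (d / δ) / n))
    (hcr : 6 ≤ cr)
    (hcr₁ : cr₁ = cr * (1 + cRE) / κ)
    (hcr₂ : cr₂ = cr * (1 + cRE) / κl)
    (hrS : rS = 12 * cr₁ * √(s : ℝ) * lamS)
    (hr₁ : r₁ = cr₁ * √(s : ℝ) * rS)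
    (hr₂ : r₂ = cr₂ * rS)
    -- the sample size conditions
    (hrS1 : rS ≤ 1)
    (hsample :
      max (9 * K ^ 2 * cr₁ * √(s * (Real.log (d / δ) / n)))
        (max (K ^ 4 / cr₁ * (⨆ j, |βstar j|) ^ (1 / 4 : ℝ) * (s : ℝ) ^ (1 / 4 : ℝ)
            * (Real.log (d / δ) / n) ^ (7 / 8 : ℝ))
          (l1Norm βstar * K ^ 4 * (Real.log (d / δ) / n) ^ (3 / 2 : ℝ))) ≤ 1) :
    -- the estimator exists, and every version of it satisfies the bounds on one event
    (∀ ω, (robustSparseEstimation (fun i => y i ω) (fun i => x i ω) τ lamO lamS).Nonempty) ∧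
    ∃ A : Set Ω, MeasurableSet A ∧ ENNReal.ofReal (1 - 2 * δ) ≤ μ A ∧
      ∀ ω ∈ A, ∀ βhat ∈ robustSparseEstimation (fun i => y i ω) (fun i => x i ω) τ lamO lamS,
        sqrtNorm S (βhat - βstar) ≤ rS ∧
        l1Norm (βhat - βstar) ≤ r₁ ∧
        (cr₁ ≤ cr₂ → ‖βhat - βstar‖ ≤ r₂) := by
  clear hsample hxid hξid hκl
  have hn' : (0 : ℝ) < n := by exact_mod_cast hn
  have hd' : (3 : ℝ) ≤ d := by exact_mod_cast hd
  have hs' : (1 : ℝ) ≤ s := by exact_mod_cast hs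
  have hκ := hRE.2.1
  have i0 : Fin n := ⟨0, hn⟩
  obtain ⟨hκ1, hK4⟩ : κ ≤ 1 ∧ 1 ≤ K ^ 4 :=
    RestrictedEigenvalue.kappa_le_one_and_one_le (μ := μ) (Z := x i0) hs (by omega)
      (by rw [hS]; exact hRE) (hxK i0) (hx0 i0) (hx2 i0)
  have hσ : 0 ≤ σ := le_trans (integral_nonneg fun ω => abs_nonneg _) (hξσ i0)
  have hL : 0 < Real.log (d / δ) := Real.log_pos (by rw [lt_div_iff₀ hδ0]; linarith)
  set r := √(Real.log (d / δ) / n) with hrdef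
  have hr : 0 < r := by positivity
  have hrn : n * r ^ 2 = Real.log (d / δ) := by
    rw [hrdef, Real.sq_sqrt (by positivity)]; field_simp
  have hrτ : r * τ = 1 := by
    rw [hrdef, hτ, ← Real.sqrt_mul (by positivity), div_mul_div_comm, mul_comm, div_self
      (by positivity), Real.sqrt_one]
  set Λ := lamO * √(n : ℝ) with hΛdef
  have hΛ18 : 18 * K ^ 4 ≤ Λ := by nlinarith only [hlamO, hσ, hK4]
  have hΛ0 : 0 < Λ := by linarith
  have hlamO0 : 0 < lamO := pos_of_mul_pos_left hΛ0 (Real.sqrt_nonneg _)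
  have hc1 : 0 < cRE - 1 := by linarith
  have hratio : 1 ≤ (cRE + 1) / (cRE - 1) := by rw [one_le_div hc1]; linarith
  have hlamS16 : 16 * (Λ * r) ≤ lamS := by
    have : 16 * 1 ≤ cs * ((cRE + 1) / (cRE - 1)) := by gcongr
    have h0 : 0 < Λ * r := by positivity
    calc 16 * (Λ * r) = 16 * 1 * (Λ * r) := by ring
      _ ≤ cs * ((cRE + 1) / (cRE - 1)) * (Λ * r) := by gcongr
      _ = lamS := by rw [hlamS]; ring
  have hlamS0 : 0 < lamS := lt_of_lt_of_le (by positivity) hlamS16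
  set D := (1 + cRE) / κ with hD
  have hD2 : 2 ≤ D := by rw [hD, le_div_iff₀ hκ]; linarith only [hκ1, hcRE]
  have hcrD : cr₁ = cr * D := by rw [hcr₁, hD]; ring
  have hcr6 : 6 * D ≤ cr₁ := by rw [hcrD]; gcongr
  have hcr₁0 : 0 < cr₁ := by linarith
  have hsq1 : 1 ≤ √(s : ℝ) := by rw [Real.one_le_sqrt]; exact hs'
  have hrS0 : 0 < rS := by rw [hrS]; positivity
  -- the single consequence of the tuning that is used below
  have hkey : 1152 * (D * √(s : ℝ)) * (Λ * r) ≤ rS := by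
    calc _ = 12 * (6 * D) * √(s : ℝ) * (16 * (Λ * r)) := by ring
      _ ≤ 12 * cr₁ * √(s : ℝ) * lamS := by gcongr
      _ = rS := hrS.symm
  -- On the cone `E` bounds the ratio of the `ℓ₁` norm to the `Σ`-norm, so `R = E * rS` is the `ℓ₁`
  -- radius of the localized sphere.
  set E := D * √(s : ℝ) with hE
  have hE2 : 2 ≤ E := by nlinarith only [hE, hD2, hsq1]
  have hEsq : E ^ 2 = D ^ 2 * s := by rw [hE, mul_pow, Real.sq_sqrt (by positivity)]
  have hsE : (s : ℝ) ≤ E ^ 2 := by 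
    rw [hEsq]
    exact le_mul_of_one_le_left (by positivity) (one_le_pow₀ (by linarith only [hD2]))
  have hKr : E * (K ^ 4 * r) ≤ 1 / 1000 := by
    have : 1152 * E * (18 * K ^ 4 * r) ≤ 1152 * E * (Λ * r) := by gcongr
    have h0 : 0 ≤ E * (K ^ 4 * r) := by positivity
    linarith only [this, h0, hkey, hrS1]
  have hKr2 : E ^ 2 * ((K ^ 4) ^ 2 * r ^ 2) ≤ 1 / 1000000 := by
    have := pow_le_pow_left₀ (by positivity) hKr 2
    calc _ = (E * (K ^ 4 * r)) ^ 2 := by ring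
      _ ≤ _ := this
      _ = _ := by norm_num
  have hK4r : E ^ 2 * (K ^ 4 * r ^ 2) ≤ 1 / 1000000 := by
    refine le_trans ?_ hKr2
    gcongr
    nlinarith only [hK4]
  have hr2 : r ^ 2 ≤ 1 := by
    have : 1 * (1 * r ^ 2) ≤ E ^ 2 * (K ^ 4 * r ^ 2) := by
      gcongr
      nlinarith only [hE2]
    linarith
  have hsmall : s * (K ^ 4) ^ 2 * r ^ 4 ≤ 1 / 100 := by
    calc s * (K ^ 4) ^ 2 * r ^ 4 = s * ((K ^ 4) ^ 2 * r ^ 2) * r ^ 2 := by ring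
      _ ≤ E ^ 2 * ((K ^ 4) ^ 2 * r ^ 2) * 1 := by gcongr
      _ ≤ _ := by linarith
  set R := E * rS with hR
  have hR0 : 0 < R := by positivity
  -- `500 (R / rS)²` vertices give the required accuracy; `E ≥ 2` absorbs the rounding and the extra
  -- one.
  obtain ⟨m, hm1, hm2⟩ : ∃ m : ℕ, 500 * E ^ 2 ≤ m ∧ (m : ℝ) + 1 ≤ 502 * E ^ 2 := by
    refine ⟨⌈500 * E ^ 2⌉₊, Nat.le_ceil _, ?_⟩
    have := Nat.ceil_lt_add_one (by positivity : 0 ≤ 500 * E ^ 2)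
    nlinarith only [this, hE2]
  have hm0 : 0 < m := by
    have : (0 : ℝ) < m := lt_of_lt_of_le (by positivity) hm1
    exact_mod_cast this
  have hx4 : ∀ i, MemLp (x i) 4 μ := fun i => (hxK i).1
  have h4 : ∀ i j, ∫ ω, x i ω j ^ 4 ∂μ ≤ K ^ 4 := fun i =>
    (hxK i).integral_coord_pow_four_le (hx0 i) (hx2 i)
  have hbias : ∀ i j, |∫ ω, trunc (clippedResidual τ Λ βstar (x i ω, ξ i ω)) * clipVec τ (x i ω) j ∂μ|
      ≤ r := fun i j => by
    have hsc := hscore i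
    simp only [huberScore_eq] at hsc
    refine (abs_integral_score_le hr hrτ (hx4 i) (hxm i) (hξm i) (h4 i) hsc hβ j).trans ?_
    have h1 : (2 * s + 1) * K ^ 4 * r ^ 3 ≤ 3 * (E ^ 2 * (K ^ 4 * r ^ 2)) * r := by
      calc _ = (2 * s + 1) * (K ^ 4 * r ^ 2) * r := by ring
        _ ≤ (3 * E ^ 2) * (K ^ 4 * r ^ 2) * r := by gcongr; linarith
        _ = _ := by ring
    nlinarith only [h1, hr, mul_le_mul_of_nonneg_right hK4r hr.le]
  refine ⟨fun ω => penalizedHuberRegression_nonempty _ _ _ hlamS0, ?_⟩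
  obtain ⟨A, hA, hAμ, hgood⟩ := exists_good_event hδ0 hδ1 hd hr hrτ hrn hΛ0 hindep hx4 hxm hξm
    hx2 hbias m R
  refine ⟨A, hA, ?_, fun ω hω βhat hβhat => ?_⟩
  · rw [← ofReal_measureReal]; exact ENNReal.ofReal_le_ofReal hAμ
  obtain ⟨hg1, hg2, hg3⟩ := hgood ω hω
  have hcurv : ∀ θ : EuclideanSpace ℝ (Fin d), sqrtNorm S θ = rS →
      κ * l1Norm θ ≤ (1 + cRE) * (√(s : ℝ) * rS) →
      n * (4 * lamS * (√(s : ℝ) * rS) / κ)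
        < ∑ i, truncatedSq (clippedResidual τ Λ βstar (x i ω, ξ i ω)) Λ
            (inner ℝ (clipVec τ (x i ω)) θ) := fun θ hθ hθ1 => by
    have hθ2 : ∀ i, ∫ ω, inner ℝ (x i ω) θ ^ 2 ∂μ = rS ^ 2 := fun i => by
      rw [← sqrtNorm_sq_eq_integral (hx4 i), hS, hθ]
    have hθ4 : ∀ i, ∫ ω, inner ℝ (x i ω) θ ^ 4 ∂μ ≤ K ^ 4 * (rS ^ 2) ^ 2 := fun i => by
      rw [← hθ2 i]; exact (hxK i).integral_inner_pow_four_le (hx0 i) θ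
    have hθR : l1Norm θ ≤ R := by
      have : R = (1 + cRE) * (√(s : ℝ) * rS) / κ := by rw [hR, hE, hD]; ring
      rw [this, le_div_iff₀ hκ]; linarith
    refine lt_of_le_of_lt ?_ (sum_truncatedSq_gt hn (by omega) hm0 hr hrτ hx4 hxm hξm hx2 h4 hξ1
      hξσ hβ hK4 hlamO hsmall hrS0 hrS1 hR0 ?_ ?_ ?_ hg2 hg3 hθR hθ2 hθ4)
    · refine mul_le_mul_of_nonneg_left ?_ hn'.le
      -- With `cr ≥ 6` and `1 + cRE ≥ 2`, the factor `12 · 6 · 2 = 36 · 4` matches the curvature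
      -- `ρ²/36` to the demand `4 lamS √s ρ / κ`.
      have h1 : 12 * (6 * (1 + cRE) / κ) * √(s : ℝ) * lamS ≤ rS := by
        rw [hrS]
        have : 6 * (1 + cRE) / κ ≤ cr₁ := by rw [hcr₁]; gcongr
        gcongr
      have h2 : 4 * lamS * √(s : ℝ) / κ ≤ rS / 36 := by
        have h3 : 12 * (6 * 2 / κ) * √(s : ℝ) * lamS
            ≤ 12 * (6 * (1 + cRE) / κ) * √(s : ℝ) * lamS := by
          gcongr; linarith
        have e : 12 * (6 * 2 / κ) * √(s : ℝ) * lamS = 36 * (4 * lamS * √(s : ℝ) / κ) := by ring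
        linarith
      calc 4 * lamS * (√(s : ℝ) * rS) / κ = 4 * lamS * √(s : ℝ) / κ * rS := by ring
        _ ≤ rS / 36 * rS := by gcongr
        _ = _ := by ring
    · rw [hR, mul_pow, ← mul_assoc]; gcongr
    · rw [hR, mul_pow]
      calc K ^ 4 * r ^ 2 * (E ^ 2 * rS ^ 2) = E ^ 2 * (K ^ 4 * r ^ 2) * rS ^ 2 := by ring
        _ ≤ 1 / 1000000 * rS ^ 2 := by gcongr
        _ ≤ _ := by nlinarith only [sq_nonneg rS]
    · have h1 := pow_le_pow_left₀ (by positivity) hkey 2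
      calc Λ ^ 2 * ((m + 1) * r ^ 2) ≤ Λ ^ 2 * (502 * E ^ 2 * r ^ 2) := by gcongr
        _ = 502 / 1152 ^ 2 * (1152 * E * (Λ * r)) ^ 2 := by ring
        _ ≤ 502 / 1152 ^ 2 * rS ^ 2 := by gcongr
        _ ≤ _ := by nlinarith only [sq_nonneg rS]
  obtain ⟨hb1, hb2, hb3⟩ := error_bound_of_gradient_of_curvature hn hs hsd.le hlamO0 hlamS0 hβ hRE
    (y := fun i => y i ω) (X := fun i => clipVec τ (x i ω))
    -- The gradient bound `4r`, multiplied by `Λ`; its domination by the penalty needs only `cs ≥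
    -- 4`.
    (u := fun i => clippedResidual τ Λ βstar (x i ω, ξ i ω)) (γ := 4 * r * Λ)
    (fun i => by simp only [clippedResidual, hy]; rfl)
    (by
      have e : lamS * (cRE - 1) = cs * (cRE + 1) * (Λ * r) := by
        rw [hlamS]; field_simp
      rw [e]
      have : 4 * (cRE + 1) * (Λ * r) ≤ cs * (cRE + 1) * (Λ * r) := by gcongr; linarith
      linarith)
    (fun j => by
      have e : 4 * r * Λ / (lamO * √(n : ℝ)) = 4 * r := by rw [← hΛdef]; field_simp
      rw [e]; exact hg1 j)
    hrS0 hcurv hβhat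
  have hDcr : D ≤ cr₁ := by linarith
  refine ⟨hb1, ?_, fun h12 => ?_⟩
  · rw [hr₁]
    calc l1Norm (βhat - βstar) ≤ D * √(s : ℝ) * rS := by
          have : D * √(s : ℝ) * rS = (1 + cRE) * (√(s : ℝ) * rS) / κ := by rw [hD]; ring
          rw [this, le_div_iff₀ hκ]; linarith
      _ ≤ _ := by gcongr
  · rw [hr₂]
    -- The Euclidean bound comes from the restricted eigenvalue condition with constant `D`; `D ≤
    -- cr₁ ≤ cr₂` turns it into `r₂`.
    calc ‖βhat - βstar‖ ≤ D * rS := by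
          have : D * rS = (1 + cRE) * rS / κ := by rw [hD]; ring
          rw [this, le_div_iff₀ hκ]; linarith
      _ ≤ cr₂ * rS := by gcongr; linarith
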